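/- Let $d\ge 1$, let $D\subset\mathbb R^d$ be a bounded open set (for instance a bounded Lipschitz domain), let $T>0$, and let $W$ be a real-valued standard Brownian motion on a probability space $(\Omega,\mathcal F,\mathbb P)$. Write $\langle\cdot,\cdot\rangle$ for the inner product of $L^2(D)$, let $H^1_0(D)$ be the closure of $C_c^\infty(D)$ in the $H^1$ norm, let $H^{-1}(D)$ be the dual space of $H^1_0(D)$, and let $\langle\cdot,\cdot\rangle_{-1}^{1}$ be the duality pairing; $L^2(D)$ is embedded in $H^{-1}(D)$ by $v\mapsto\langle v,\cdot\rangle$. Let $\Delta$ be the Dirichlet Laplacian in $L^2(D)$, with domain $\mathrm{Dom}(\Delta)=\{v\in H^1_0(D):\Delta v\in L^2(D)\}$. Let $f\in L^2([0,T])$ and $g\in H^1_0(D)$ be deterministic, and for $m\in\{1,2\}$ consider $$\partial_t^m u-\Delta u=g(x)f(t)\dot W(t)\ \text{ in } D\times(0,T],\qquad u=0 \text{ on }\partial D,\qquad u(\cdot,0)=0,\qquad \partial_tu(\cdot,0)=0\ (\text{only if } m=2).$$ A jointly measurable process $X$ on $[0,T]$ with values in a Hilbert space $E$ is a strong solution of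 $dX=-AX\,dt+B\,dW$, $X(0)=0$, where $A$ is an unbounded linear operator in $E$ and $B$ is deterministic, if almost surely $X(t)\in\mathrm{Dom}(A)$ for almost every $t\in[0,T]$ and $AX$ is Bochner integrable over $[0,T]$, the stochastic integral $\int_0^tB\,dW$ exists for every $t\in[0,T]$, and for every $t\in[0,T]$, almost surely, $X(t)=-\int_0^tAX(s)\,ds+\int_0^tB(s)\,dW(s)$. A strong solution $u$ of the equation for $m=1$ is understood in this sense with $E=L^2(D)$, $A=-\Delta$, $B(t)=f(t)g$. For $m=2$ it means that $X=(u,\partial_tu)$ is a strong solution in this sense with $E=H^1_0(D)\times L^2(D)$, $A(u,p)=(-p,-\Delta u)$, $\mathrm{Dom}(A)=\mathrm{Dom}(\Delta)\times H^1_0(D)$, $B(t)=(0,f(t)g)$. Derivatives of $\zeta$ in $t$ below are weak derivatives on $(0,T)$ of Banach space valued functions. (i) Let $m=1$ and let $u$ be a strong solution. For every (deterministic) $\zeta\in L^2([0,T];H^1_0(D))$ with $\partial_t\zeta\in L^2([0,T];H^{-1}(D))$ and for almost every $t\in[0,T]$, all the integrals below exist and, almost surely, $$\langle u(\cdot,t),\zeta(\cdot,t)\rangle=\int_0^t\langle\Delta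 u(\cdot,s),\zeta(\cdot,s)\rangle\,ds+\int_0^t\langle u(\cdot,s),\partial_s\zeta(\cdot,s)\rangle_{-1}^{1}\,ds+\int_0^tf(s)\langle g,\zeta(\cdot,s)\rangle\,dW(s).$$ (ii) Let $m=2$ and let $u$ be a strong solution. For every (deterministic) $\zeta\in L^2([0,T];H^1_0(D))$ with $\partial_t\zeta\in L^2([0,T];L^2(D))$ and $\partial_{tt}\zeta\in L^2([0,T];H^{-1}(D))$ and for almost every $t\in[0,T]$, all the integrals below exist and, almost surely, $$\langle\partial_tu(\cdot,t),\zeta(\cdot,t)\rangle-\langle u(\cdot,t),\partial_t\zeta(\cdot,t)\rangle=\int_0^t\langle\Delta u(\cdot,s),\zeta(\cdot,s)\rangle\,ds-\int_0^t\langle u(\cdot,s),\partial_{ss}\zeta(\cdot,s)\rangle_{-1}^{1}\,ds+\int_0^tf(s)\langle g,\zeta(\cdot,s)\rangle\,dW(s).$$ -/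

import Mathlib

open MeasureTheory ProbabilityTheory Set Filter Topology TopologicalSpace
open scoped NNReal ENNReal Distributions Gradient

noncomputable section

namespace StochEvol

/-! ### Function spaces on an open set `D ⊆ ℝᵈ` -/

/-- `ℝᵈ` with the Euclidean norm. -/
abbrev Euc (d : ℕ) : Type := EuclideanSpace ℝ (Fin d)

/-- The Hilbert space `L²(D)`. -/
abbrev L2 {d : ℕ} (D : Opens (Euc d)) : Type :=
  Lp ℝ 2 (volume.restrict (D : Set (Euc d)))

/-- The Hilbert space `L²(D; ℝᵈ)` of square integrable vector fields. -/
abbrev L2Vec {d : ℕ} (D : Opens (Euc d)) : Type :=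
  Lp (Euc d) 2 (volume.restrict (D : Set (Euc d)))

/-- The pairs `(φ, ∇φ) ∈ L²(D) × L²(D; ℝᵈ)` with `φ` a smooth function with compact support in `D`.
The norm of the ambient space, `‖(v, F)‖² = ‖v‖² + ‖F‖²`, is the `H¹` norm on such pairs. -/
def testGraph {d : ℕ} (D : Opens (Euc d)) : Submodule ℝ (WithLp 2 (L2 D × L2Vec D)) where
  carrier := {z | ∃ φ : 𝓓(D, ℝ),
    z.fst =ᵐ[volume.restrict (D : Set (Euc d))] (fun x => φ x) ∧
    z.snd =ᵐ[volume.restrict (D : Set (Euc d))] (fun x => ∇ (fun y => φ y) x)}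
  zero_mem' := by
    refine ⟨0, ?_, ?_⟩
    · exact Lp.coeFn_zero ℝ 2 _
    · refine (Lp.coeFn_zero (Euc d) 2 _).trans (Eventually.of_forall fun x => ?_)
      exact (gradient_fun_const x (0 : ℝ)).symm
  add_mem' := by
    rintro z z' ⟨φ, h1, h2⟩ ⟨ψ, h3, h4⟩
    refine ⟨φ + ψ, ?_, ?_⟩
    · refine (Lp.coeFn_add z.fst z'.fst).trans ?_
      filter_upwards [h1, h3] with x hx hx'
      simp [hx, hx']
    · refine (Lp.coeFn_add z.snd z'.snd).trans ?_
      filter_upwards [h2, h4] with x hx hx'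
      have hφ : DifferentiableAt ℝ (fun y => φ y) x := φ.contDiff.differentiable (by simp) x
      have hψ : DifferentiableAt ℝ (fun y => ψ y) x := ψ.contDiff.differentiable (by simp) x
      have : fderiv ℝ (fun y => (φ + ψ) y) x
          = fderiv ℝ (fun y => φ y) x + fderiv ℝ (fun y => ψ y) x := fderiv_add hφ hψ
      simp only [Pi.add_apply, hx, hx', gradient, this, map_add]
  smul_mem' := by
    rintro c z ⟨φ, h1, h2⟩
    refine ⟨c • φ, ?_, ?_⟩
    · refine (Lp.coeFn_smul c z.fst).trans ?_
      filter_upwards [h1] with x hx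
      simp [hx]
    · refine (Lp.coeFn_smul c z.snd).trans ?_
      filter_upwards [h2] with x hx
      have hφ : DifferentiableAt ℝ (fun y => φ y) x := φ.contDiff.differentiable (by simp) x
      have : fderiv ℝ (fun y => (c • φ) y) x = c • fderiv ℝ (fun y => φ y) x :=
        fderiv_const_smul hφ c
      simp only [Pi.smul_apply, hx, gradient, this, map_smul]

/-- The Sobolev space `H¹₀(D)`: the closure of `C_c^∞(D)` in the `H¹` norm. An element is stored as
the pair `(v, ∇v)` of a function and its weak gradient. -/
abbrev H10 {d : ℕ} (D : Opens (Euc d)) : Type :=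
  (testGraph D).topologicalClosure

/-- The dual space `H⁻¹(D)` of `H¹₀(D)`. -/
abbrev HNeg1 {d : ℕ} (D : Opens (Euc d)) : Type := StrongDual ℝ (H10 D)

/-- The embedding `H¹₀(D) → L²(D)`. -/
def toL2 {d : ℕ} (D : Opens (Euc d)) : H10 D →L[ℝ] L2 D :=
  (WithLp.fstL 2 ℝ (L2 D) (L2Vec D)).comp (testGraph D).topologicalClosure.subtypeL

/-- The weak gradient `H¹₀(D) → L²(D; ℝᵈ)`. -/
def grad {d : ℕ} (D : Opens (Euc d)) : H10 D →L[ℝ] L2Vec D :=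
  (WithLp.sndL 2 ℝ (L2 D) (L2Vec D)).comp (testGraph D).topologicalClosure.subtypeL

/-- The embedding `L²(D) → H⁻¹(D)`, `v ↦ ⟨v, ·⟩`. -/
def toHNeg1 {d : ℕ} (D : Opens (Euc d)) (v : L2 D) : HNeg1 D :=
  (innerSL ℝ v).comp (toL2 D)

/-- An element of `L²(D)` that lies in `H¹₀(D)`, as an element of `H¹₀(D)`; see `liftH10_toL2`
(elements outside `H¹₀(D)` are sent to an arbitrary value). -/
def liftH10 {d : ℕ} (D : Opens (Euc d)) (v : L2 D) : H10 D :=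
  Function.invFun (toL2 D) v

/-- The graph of the Dirichlet Laplacian `Δ` in `L²(D)`: the pairs `(v, h)` with `v ∈ H¹₀(D)`,
`h ∈ L²(D)` and `∫ ∇v · ∇φ = -∫ h φ` for all `φ ∈ H¹₀(D)`. -/
def dirichletGraph {d : ℕ} (D : Opens (Euc d)) : Submodule ℝ (L2 D × L2 D) where
  carrier := {z | ∃ v : H10 D, toL2 D v = z.1 ∧
    ∀ φ : H10 D, inner ℝ (grad D v) (grad D φ) = - inner ℝ z.2 (toL2 D φ)}
  zero_mem' := ⟨0, by simp, by simp⟩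
  add_mem' := by
    rintro z z' ⟨v, h1, h2⟩ ⟨v', h3, h4⟩
    refine ⟨v + v', by simp [h1, h3], fun φ => ?_⟩
    simp only [map_add, inner_add_left, h2, h4, Prod.snd_add]
    ring
  smul_mem' := by
    rintro c z ⟨v, h1, h2⟩
    refine ⟨c • v, by simp [h1], fun φ => ?_⟩
    simp only [map_smul, real_inner_smul_left, h2, Prod.smul_snd]
    ring

/-- The Dirichlet Laplacian `Δ` on `D`, an unbounded operator in `L²(D)` with domain
`{v ∈ H¹₀(D) | Δv ∈ L²(D)}`. -/
def dirichletLaplacian {d : ℕ} (D : Opens (Euc d)) : L2 D →ₗ.[ℝ] L2 D :=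
  (dirichletGraph D).toLinearPMap

/-- The Hilbert space `H¹₀(D) × L²(D)` of pairs `(u, ∂ₜu)`. -/
abbrev WaveSpace {d : ℕ} (D : Opens (Euc d)) : Type := WithLp 2 (H10 D × L2 D)

/-- The graph of the wave operator: the pairs `((u, p), (-q, -Δu))` with `u ∈ Dom(Δ)` and
`q ∈ H¹₀(D)` equal to `p`. -/
def waveGraph {d : ℕ} (D : Opens (Euc d)) : Submodule ℝ (WaveSpace D × WaveSpace D) where
  carrier := {z | toL2 D z.2.fst = - z.1.snd ∧ (toL2 D z.1.fst, - z.2.snd) ∈ dirichletGraph D}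
  zero_mem' := by
    refine ⟨?_, ?_⟩
    · rw [Prod.fst_zero, Prod.snd_zero, WithLp.zero_fst, WithLp.zero_snd, map_zero, neg_zero]
    · rw [Prod.fst_zero, Prod.snd_zero, WithLp.zero_fst, WithLp.zero_snd, map_zero, neg_zero]
      exact (dirichletGraph D).zero_mem
  add_mem' := by
    rintro z z' ⟨h1, h2⟩ ⟨h3, h4⟩
    refine ⟨?_, ?_⟩
    · rw [Prod.fst_add, Prod.snd_add, WithLp.add_fst, WithLp.add_snd, map_add, h1, h3, neg_add]
    · rw [Prod.fst_add, Prod.snd_add, WithLp.add_fst, WithLp.add_snd, map_add, neg_add]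
      exact (dirichletGraph D).add_mem h2 h4
  smul_mem' := by
    rintro c z ⟨h1, h2⟩
    refine ⟨?_, ?_⟩
    · rw [Prod.smul_fst, Prod.smul_snd, WithLp.smul_fst, WithLp.smul_snd, map_smul, h1, smul_neg]
    · rw [Prod.smul_fst, Prod.smul_snd, WithLp.smul_fst, WithLp.smul_snd, map_smul, ← smul_neg]
      exact (dirichletGraph D).smul_mem c h2

/-- The wave operator `(u, p) ↦ (-p, -Δu)` in `H¹₀(D) × L²(D)`, with domain `Dom(Δ) × H¹₀(D)`. -/
def waveOperator {d : ℕ} (D : Opens (Euc d)) : WaveSpace D →ₗ.[ℝ] WaveSpace D :=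
  (waveGraph D).toLinearPMap

/-! ### The definitions above are consistent -/

lemma memLp_of_continuous {d : ℕ} (D : Opens (Euc d)) {F : Type*} [NormedAddCommGroup F]
    {a : Euc d → F} (h : Continuous a) (hc : HasCompactSupport a) :
    MemLp a 2 (volume.restrict (D : Set (Euc d))) :=
  (h.memLp_of_hasCompactSupport hc).restrict _

lemma continuous_fderiv_testFunction {d : ℕ} {D : Opens (Euc d)} (ψ : 𝓓(D, ℝ)) (e : Euc d) :
    Continuous (fun x => fderiv ℝ (fun y => ψ y) x e) :=
  (ψ.contDiff.continuous_fderiv (by simp)).clm_apply continuous_const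

lemma hasCompactSupport_fderiv_testFunction {d : ℕ} {D : Opens (Euc d)} (ψ : 𝓓(D, ℝ))
    (e : Euc d) : HasCompactSupport (fun x => fderiv ℝ (fun y => ψ y) x e) :=
  ψ.hasCompactSupport.fderiv_apply ℝ e

lemma setIntegral_testFunction {d : ℕ} {D : Opens (Euc d)} {a : Euc d → ℝ} (ψ : 𝓓(D, ℝ))
    (h : ∀ x, ψ x = 0 → a x = 0) : ∫ x in (D : Set (Euc d)), a x = ∫ x, a x := by
  refine setIntegral_eq_integral_of_forall_compl_eq_zero fun x hx => h x ?_
  by_contra hne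
  exact hx (ψ.tsupport_subset (subset_tsupport _ hne))

lemma weak_gradient {d : ℕ} (D : Opens (Euc d)) (w : H10 D) (ψ : 𝓓(D, ℝ)) (e : Euc d) :
    ∫ x in (D : Set (Euc d)), ψ x * inner ℝ (grad D w x) e
      = - ∫ x in (D : Set (Euc d)), toL2 D w x * fderiv ℝ (fun y => ψ y) x e := by
  have ha : MemLp (fun x => ψ x • e) 2 (volume.restrict (D : Set (Euc d))) :=
    memLp_of_continuous D (ψ.continuous.smul continuous_const) ψ.hasCompactSupport.smul_right
  have hb : MemLp (fun x => fderiv ℝ (fun y => ψ y) x e) 2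
      (volume.restrict (D : Set (Euc d))) :=
    memLp_of_continuous D (continuous_fderiv_testFunction ψ e)
      (hasCompactSupport_fderiv_testFunction ψ e)
  have hA : ∀ F : L2Vec D, inner ℝ ha.toLp F
      = ∫ x in (D : Set (Euc d)), ψ x * inner ℝ (F x) e := by
    intro F
    rw [L2.inner_def]
    refine integral_congr_ae ?_
    filter_upwards [ha.coeFn_toLp] with x hx
    rw [hx, real_inner_smul_left, real_inner_comm]
  have hB : ∀ v : L2 D, inner ℝ hb.toLp v
      = ∫ x in (D : Set (Euc d)), v x * fderiv ℝ (fun y => ψ y) x e := by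
    intro v
    rw [L2.inner_def]
    refine integral_congr_ae ?_
    filter_upwards [hb.coeFn_toLp] with x hx
    rw [hx]
    simp
  have key : ∀ z ∈ (testGraph D).topologicalClosure,
      inner ℝ ha.toLp z.snd = - inner ℝ hb.toLp z.fst := by
    have hcl : IsClosed {z : WithLp 2 (L2 D × L2Vec D) |
        inner ℝ ha.toLp z.snd = - inner ℝ hb.toLp z.fst} := by
      refine isClosed_eq ?_ ?_
      · exact continuous_const.inner (WithLp.sndL 2 ℝ (L2 D) (L2Vec D)).continuous
      · exact (continuous_const.inner (WithLp.fstL 2 ℝ (L2 D) (L2Vec D)).continuous).neg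
    have hsub : (testGraph D : Set (WithLp 2 (L2 D × L2Vec D))) ⊆
        {z | inner ℝ ha.toLp z.snd = - inner ℝ hb.toLp z.fst} := by
      rintro z ⟨φ, h1, h2⟩
      change inner ℝ ha.toLp z.snd = - inner ℝ hb.toLp z.fst
      rw [hA, hB]
      have hdφ : Differentiable ℝ (fun y => φ y) := φ.contDiff.differentiable (by simp)
      have hdψ : Differentiable ℝ (fun y => ψ y) := ψ.contDiff.differentiable (by simp)
      have e1 : ∫ x in (D : Set (Euc d)), ψ x * inner ℝ (z.snd x) e
          = ∫ x in (D : Set (Euc d)), ψ x * fderiv ℝ (fun y => φ y) x e := by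
        refine integral_congr_ae ?_
        filter_upwards [h2] with x hx
        rw [hx, inner_gradient_left]
      have e2 : ∫ x in (D : Set (Euc d)), z.fst x * fderiv ℝ (fun y => ψ y) x e
          = ∫ x in (D : Set (Euc d)), φ x * fderiv ℝ (fun y => ψ y) x e := by
        refine integral_congr_ae ?_
        filter_upwards [h1] with x hx
        rw [hx]
      rw [e1, e2, setIntegral_testFunction ψ (fun x hx => by simp [hx]),
        setIntegral_testFunction φ (fun x hx => by simp [hx])]
      rw [integral_mul_fderiv_eq_neg_fderiv_mul_of_integrable]
      · congr 1
        exact integral_congr_ae (Eventually.of_forall fun x => mul_comm _ _)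
      · exact ((continuous_fderiv_testFunction ψ e).mul φ.continuous).integrable_of_hasCompactSupport
          (hasCompactSupport_fderiv_testFunction ψ e).mul_right
      · exact (ψ.continuous.mul (continuous_fderiv_testFunction φ e)).integrable_of_hasCompactSupport
          ψ.hasCompactSupport.mul_right
      · exact (ψ.continuous.mul φ.continuous).integrable_of_hasCompactSupport
          ψ.hasCompactSupport.mul_right
      · exact fun x _ => hdψ x
      · exact fun x _ => hdφ x
    exact fun z hz => closure_minimal hsub hcl hz
  have := key w.1 w.2
  rwa [hA, hB] at this

/-- The element of `H¹₀(D)` given by a test function. -/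
lemma exists_toL2_eq {d : ℕ} (D : Opens (Euc d)) (φ : 𝓓(D, ℝ)) :
    ∃ w : H10 D, toL2 D w =ᵐ[volume.restrict (D : Set (Euc d))] (fun x => φ x) := by
  have h1 : MemLp (fun x => φ x) 2 (volume.restrict (D : Set (Euc d))) :=
    memLp_of_continuous D φ.continuous φ.hasCompactSupport
  have h2 : MemLp (fun x => ∇ (fun y => φ y) x) 2 (volume.restrict (D : Set (Euc d))) := by
    refine memLp_of_continuous D ?_ ?_
    · exact (InnerProductSpace.toDual ℝ (Euc d)).symm.continuous.comp
        (φ.contDiff.continuous_fderiv (by simp))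
    · exact (φ.hasCompactSupport.fderiv ℝ).comp_left (map_zero _)
  exact ⟨⟨WithLp.toLp 2 (h1.toLp, h2.toLp), Submodule.le_topologicalClosure _
    ⟨φ, h1.coeFn_toLp, h2.coeFn_toLp⟩⟩, h1.coeFn_toLp⟩

lemma ae_eq_zero_of_testFunction {d : ℕ} (D : Opens (Euc d)) {a : Euc d → ℝ}
    (ha : MemLp a 2 (volume.restrict (D : Set (Euc d))))
    (h : ∀ ψ : 𝓓(D, ℝ), ∫ x in (D : Set (Euc d)), ψ x * a x = 0) :
    a =ᵐ[volume.restrict (D : Set (Euc d))] 0 := by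
  have hloc : LocallyIntegrableOn a (D : Set (Euc d)) volume := by
    refine (locallyIntegrableOn_iff D.isOpen.isLocallyClosed).2 fun k hk hkc => ?_
    have hm : MemLp a 2 (volume.restrict k) := ha.mono_measure (Measure.restrict_mono hk le_rfl)
    have : IsFiniteMeasure ((volume : Measure (Euc d)).restrict k) :=
      ⟨by simpa using hkc.measure_lt_top⟩
    exact hm.integrable (by norm_num)
  have := D.isOpen.ae_eq_zero_of_integral_contDiff_smul_eq_zero hloc fun ψ h1 h2 h3 => by
    have e := h ⟨ψ, h1, h2, h3⟩
    rw [setIntegral_testFunction (⟨ψ, h1, h2, h3⟩ : 𝓓(D, ℝ)) (fun x hx => by simp [hx])] at e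
    exact e
  exact (ae_restrict_iff' D.isOpen.measurableSet).2 this

/-- A function in `H¹₀(D)` has only one weak gradient. -/
lemma toL2_injective {d : ℕ} (D : Opens (Euc d)) : Function.Injective (toL2 D) := by
  rw [injective_iff_map_eq_zero]
  intro w hw
  have h0 : toL2 D w =ᵐ[volume.restrict (D : Set (Euc d))] 0 := by
    rw [hw]; exact Lp.coeFn_zero ℝ 2 _
  have hg : grad D w = 0 := by
    have hi : ∀ i : Fin d, (fun x => inner ℝ (grad D w x) (EuclideanSpace.single i (1 : ℝ)))
        =ᵐ[volume.restrict (D : Set (Euc d))] 0 := by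
      intro i
      refine ae_eq_zero_of_testFunction D ?_ fun ψ => ?_
      · exact (Lp.memLp (grad D w)).inner_const _
      · rw [weak_gradient, neg_eq_zero]
        refine integral_eq_zero_of_ae ?_
        filter_upwards [h0] with x hx
        simp [hx]
    rw [Lp.eq_zero_iff_ae_eq_zero]
    filter_upwards [ae_all_iff.2 hi] with x hx
    ext i
    simpa [EuclideanSpace.inner_single_right] using hx i
  apply Subtype.ext
  apply WithLp.ofLp_injective
  exact Prod.ext hw hg

lemma liftH10_toL2 {d : ℕ} (D : Opens (Euc d)) (w : H10 D) : liftH10 D (toL2 D w) = w :=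
  Function.leftInverse_invFun (toL2_injective D) w

/-- `H¹₀(D)` is dense in `L²(D)`. -/
lemma eq_zero_of_inner_toL2 {d : ℕ} (D : Opens (Euc d)) (h : L2 D)
    (hh : ∀ φ : H10 D, inner ℝ h (toL2 D φ) = 0) : h = 0 := by
  rw [Lp.eq_zero_iff_ae_eq_zero]
  refine ae_eq_zero_of_testFunction D (Lp.memLp h) fun ψ => ?_
  obtain ⟨w, hw⟩ := exists_toL2_eq D ψ
  rw [← hh w, L2.inner_def]
  refine integral_congr_ae ?_
  filter_upwards [hw] with x hx
  rw [hx]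
  simp

lemma dirichletGraph_functional {d : ℕ} (D : Opens (Euc d)) :
    ∀ z ∈ dirichletGraph D, z.1 = 0 → z.2 = 0 := by
  rintro z ⟨v, h1, h2⟩ h0
  have hv : v = 0 := toL2_injective D (by rw [h1, h0, map_zero])
  refine eq_zero_of_inner_toL2 D _ fun φ => ?_
  have := h2 φ
  rw [hv, map_zero, inner_zero_left] at this
  linarith

lemma dirichletLaplacian_graph {d : ℕ} (D : Opens (Euc d)) :
    (dirichletLaplacian D).graph = dirichletGraph D :=
  Submodule.toLinearPMap_graph_eq _ (dirichletGraph_functional D)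

lemma waveOperator_graph {d : ℕ} (D : Opens (Euc d)) :
    (waveOperator D).graph = waveGraph D := by
  refine Submodule.toLinearPMap_graph_eq _ ?_
  rintro z ⟨h1, h2⟩ h0
  have e1 : z.1.fst = 0 := by rw [h0]; rfl
  have e2 : z.1.snd = 0 := by rw [h0]; rfl
  have f1 : z.2.fst = 0 := toL2_injective D (by rw [h1, e2, map_zero, neg_zero])
  have f2 : z.2.snd = 0 := by
    have := dirichletGraph_functional D _ h2 (by simp [e1])
    simpa using this
  exact WithLp.ofLp_injective 2 (Prod.ext f1 f2)

/-! ### The stochastic integral of a deterministic integrand -/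

/-- A step function `∑ᵢ cᵢ 1_{(aᵢ, bᵢ]}` on `[0, ∞)` with values in `E`. -/
structure StepFunction (E : Type*) where
  n : ℕ
  left : Fin n → ℝ≥0
  right : Fin n → ℝ≥0
  left_le_right : ∀ i, left i ≤ right i
  coef : Fin n → E

namespace StepFunction

variable {E : Type*} [NormedAddCommGroup E] [InnerProductSpace ℝ E]

/-- The function `∑ᵢ cᵢ 1_{(aᵢ, bᵢ]}`. -/
def eval (S : StepFunction E) (s : ℝ) : E :=
  ∑ i, (Ioc (S.left i : ℝ) (S.right i : ℝ)).indicator (fun _ => S.coef i) s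

/-- The elementary integral `∑ᵢ (W(bᵢ) - W(aᵢ)) cᵢ`. -/
def integral (S : StepFunction E) {Ω : Type*} (W : ℝ≥0 → Ω → ℝ) (ω : Ω) : E :=
  ∑ i, (W (S.right i) ω - W (S.left i) ω) • S.coef i

end StepFunction

/-- `I = ∫₀ᵗ B(s) dW(s)` for a deterministic Hilbert space valued `B`: the random variable `I` is
the limit in `L²(Ω; E)` of the elementary integrals of step functions on `(0, t]` that converge to
`B` in `L²((0, t); E)`. When `W` is a Brownian motion, such an `I` exists exactly when
`B ∈ L²((0, t); E)`, and it is unique up to almost sure equality. -/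
structure IsWienerIntegral {Ω : Type*} [MeasurableSpace Ω] (P : Measure Ω) (W : ℝ≥0 → Ω → ℝ)
    {E : Type*} [NormedAddCommGroup E] [InnerProductSpace ℝ E]
    (t : ℝ) (B : ℝ → E) (I : Ω → E) : Prop where
  memLp : MemLp I 2 P
  approx : ∃ S : ℕ → StepFunction E,
    (∀ k i, ((S k).right i : ℝ) ≤ t) ∧
    Tendsto (fun k => eLpNorm (fun s => (S k).eval s - B s) 2 (volume.restrict (Ioc 0 t)))
      atTop (𝓝 0) ∧
    Tendsto (fun k => eLpNorm (fun ω => (S k).integral W ω - I ω) 2 P) atTop (𝓝 0)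

/-! ### Strong solutions -/

open Classical in
/-- An unbounded operator, extended by zero outside its domain. -/
def applyOrZero {E F : Type*} [AddCommGroup E] [Module ℝ E] [AddCommGroup F] [Module ℝ F]
    (A : E →ₗ.[ℝ] F) (x : E) : F :=
  if h : x ∈ A.domain then A ⟨x, h⟩ else 0

/-- `X` is a strong solution on `[0, T]` of `dX = -A X dt + B dW`, `X(0) = 0`, where `B` is
deterministic: `X` is a (jointly measurable) process, almost surely `X(t) ∈ Dom(A)` for almost
every `t` and `AX` is Bochner integrable over `[0, T]`, and for every `t ∈ [0, T]`, almost surely,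
`X(t) = -∫₀ᵗ A X(s) ds + ∫₀ᵗ B(s) dW(s)`. -/
structure IsStrongSolution {Ω : Type*} [MeasurableSpace Ω] (P : Measure Ω) (W : ℝ≥0 → Ω → ℝ)
    {E : Type*} [NormedAddCommGroup E] [InnerProductSpace ℝ E] [CompleteSpace E]
    (T : ℝ) (A : E →ₗ.[ℝ] E) (B : ℝ → E) (X : ℝ → Ω → E) : Prop where
  measurable : ∀ t ∈ Icc 0 T, AEStronglyMeasurable (X t) P
  measurable_uncurry : AEStronglyMeasurable (fun z : ℝ × Ω => X z.1 z.2)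
    ((volume.restrict (Icc 0 T)).prod P)
  mem_domain : ∀ᵐ ω ∂P, ∀ᵐ t ∂(volume.restrict (Icc 0 T)), X t ω ∈ A.domain
  integrable : ∀ᵐ ω ∂P, IntegrableOn (fun t => applyOrZero A (X t ω)) (Icc 0 T)
  eq : ∀ t ∈ Icc 0 T, ∃ I : Ω → E, IsWienerIntegral P W t B I ∧
    ∀ᵐ ω ∂P, X t ω = -(∫ s in 0..t, applyOrZero A (X s ω)) + I ω

/-- `u` is a strong solution on `[0, T]` of the stochastic heat equation `∂ₜu - Δu = g f Ẇ` in `D`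
with `u = 0` on `∂D` and `u(0) = 0`. -/
def IsStrongSolutionHeat {d : ℕ} (D : Opens (Euc d)) {Ω : Type*} [MeasurableSpace Ω]
    (P : Measure Ω) (W : ℝ≥0 → Ω → ℝ) (T : ℝ) (f : ℝ → ℝ) (g : L2 D) (u : ℝ → Ω → L2 D) : Prop :=
  IsStrongSolution P W T (-dirichletLaplacian D) (fun s => f s • g) u

/-- `u`, with time derivative `u'`, is a strong solution on `[0, T]` of the stochastic wave equation
`∂ₜₜu - Δu = g f Ẇ` in `D` with `u = 0` on `∂D` and `u(0) = ∂ₜu(0) = 0`: the pair `(u, u')` is a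
strong solution of the first order system. -/
def IsStrongSolutionWave {d : ℕ} (D : Opens (Euc d)) {Ω : Type*} [MeasurableSpace Ω]
    (P : Measure Ω) (W : ℝ≥0 → Ω → ℝ) (T : ℝ) (f : ℝ → ℝ) (g : L2 D)
    (u : ℝ → Ω → H10 D) (u' : ℝ → Ω → L2 D) : Prop :=
  IsStrongSolution P W T (waveOperator D)
    (fun s => (WithLp.toLp 2 ((0 : H10 D), f s • g) : WaveSpace D))
    (fun t ω => (WithLp.toLp 2 (u t ω, u' t ω) : WaveSpace D))

/-! ### Weak time derivatives -/

/-- `y'` is the weak derivative on `(0, T)` of the Banach space valued function `y`. -/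
def HasWeakTimeDeriv {F : Type*} [NormedAddCommGroup F] [NormedSpace ℝ F]
    (T : ℝ) (y y' : ℝ → F) : Prop :=
  ∀ φ : 𝓓((⟨Ioo 0 T, isOpen_Ioo⟩ : Opens ℝ), ℝ),
    ∫ t in 0..T, deriv (fun s => φ s) t • y t = - ∫ t in 0..T, φ t • y' t

end StochEvol

end

open StochEvol MeasureTheory ProbabilityTheory Set TopologicalSpace
open scoped NNReal ENNReal

open MeasureTheory ProbabilityTheory Set Filter Topology TopologicalSpace
open scoped NNReal ENNReal Distributions Gradient

noncomputable section

namespace StochEvol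

open ContinuousLinearMap (adjoint adjoint_inner_left adjoint_inner_right)

/-! ### Primitives of Bochner integrable functions -/

section Primitive

variable {E F G : Type*} [NormedAddCommGroup E] [NormedSpace ℝ E]
  [NormedAddCommGroup F] [NormedSpace ℝ F]
  [NormedAddCommGroup G] [NormedSpace ℝ G]

/-! For the forcing `f(t) g` the whole noise is `M(t) g` with one real process `M(t) = ∫₀ᵗ F dW`,
where `F g = f g`. Hence, on almost every path, `u - M g` (heat) or `∂ₜu - M g` (wave) is the
primitive of `Δu`, and the theorem splits into a deterministic product rule along paths and a scalar
stochastic identity. Pairing with `ζ` leaves the noise terms `M(t) ψ(t) - ∫₀ᵗ ψ' M ds`, where `ψ =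
⟨g, ζ⟩` has a square integrable derivative; this is `∫₀ᵗ F ψ dW`.

The scalar identity, `isWienerIntegral_mul_primitive`, is proved by duality. The closure in `L²(0,t)
× L²(Ω)` of the pairs (step function, elementary integral) is its own double orthogonal complement.
If `(a, w)` is orthogonal to every Wiener pair, then `E[w M(s)] = -∫₀ˢ a F`, and orthogonality to
the desired pair becomes the product rule `bilin_primitive` for the primitives of `a F` and `ψ'`.

For the heat equation `Δu` is only known to be integrable in time, while `ζ` is a primitive only in
`H⁻¹`. Testing the equation with `u` and inserting `u = ∫ Δu + M g`, where `g ∈ H¹₀`, gives `u ∈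
L²(0,t; H¹₀)` (`memLp_of_heat`), so `Δu ∈ L²(0,t; H⁻¹)`. This is the setting of the product rule in
a Gelfand triple, `inner_primitive_of_gelfand`: with `H⁻¹` identified with `H¹₀` by Riesz, the
inclusion `H¹₀ → H⁻¹` becomes `J†J`, and `(J†J + ε)⁻¹` turns functions that are primitives in `H⁻¹`
into approximations in `H¹₀`.

For the wave equation no regularization is needed (`inner_wave_path`): `Δu` meets `ζ`, a primitive
in `L²(D)`, and `∂ₜu`, integrable in `H¹₀`, meets `J† ∂ₜζ`, a primitive in `H¹₀`.

The exceptional times are `t = 0` and those at which `ζ` (or `∂ₜζ`) differs from its continuous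
representative. -/

lemma continuousOn_add_primitive {β : ℝ → F} {t : ℝ}
    (hβ : IntegrableOn β (Ioc 0 t)) (b : F) :
    ContinuousOn (fun s => b + ∫ r in 0..s, β r) (Icc 0 t) := by
  rcases lt_or_ge t 0 with ht | ht
  · simp [Icc_eq_empty_of_lt ht]
  · rw [← uIcc_of_le ht]
    refine continuousOn_const.add (intervalIntegral.continuousOn_primitive_interval ?_)
    rwa [uIcc_of_le ht, integrableOn_Icc_iff_integrableOn_Ioc]

lemma aestronglyMeasurable_add_primitive {β : ℝ → F} {t : ℝ}
    (hβ : IntegrableOn β (Ioc 0 t)) (b : F) :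
    AEStronglyMeasurable (fun s => b + ∫ r in 0..s, β r) (volume.restrict (Ioc 0 t)) :=
  ((continuousOn_add_primitive hβ b).mono Ioc_subset_Icc_self).aestronglyMeasurable
    measurableSet_Ioc

lemma exists_norm_add_primitive_le {β : ℝ → F} {t : ℝ}
    (hβ : IntegrableOn β (Ioc 0 t)) (b : F) :
    ∃ C : ℝ, ∀ s ∈ Icc 0 t, ‖b + ∫ r in 0..s, β r‖ ≤ C :=
  isCompact_Icc.exists_bound_of_continuousOn (continuousOn_add_primitive hβ b)

lemma integrableOn_bilin_primitive (B : E →L[ℝ] F →L[ℝ] G) {α : ℝ → E} {β : ℝ → F} {t : ℝ}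
    (hα : IntegrableOn α (Ioc 0 t)) (hβ : IntegrableOn β (Ioc 0 t)) (b : F) :
    IntegrableOn (fun s => B (α s) (b + ∫ r in 0..s, β r)) (Ioc 0 t) := by
  obtain ⟨C, hC⟩ := exists_norm_add_primitive_le hβ b
  refine Integrable.mono' ((hα.norm.const_mul ‖B‖).mul_const C) ?_ ?_
  · exact B.aestronglyMeasurable_comp₂ hα.1 (aestronglyMeasurable_add_primitive hβ b)
  · filter_upwards [ae_restrict_mem measurableSet_Ioc] with s hs
    refine (B.le_opNorm₂ _ _).trans ?_
    gcongr
    exact hC s (Ioc_subset_Icc_self hs)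

variable [CompleteSpace E] [CompleteSpace F] [CompleteSpace G]

/-- The product rule for primitives of Bochner integrable functions. -/
theorem bilin_primitive (B : E →L[ℝ] F →L[ℝ] G) {α : ℝ → E} {β : ℝ → F} {t : ℝ} (ht : 0 ≤ t)
    (hα : IntegrableOn α (Ioc 0 t)) (hβ : IntegrableOn β (Ioc 0 t)) (b : F) :
    B (∫ s in 0..t, α s) (b + ∫ s in 0..t, β s)
      = (∫ s in 0..t, B (α s) (b + ∫ r in 0..s, β r))
        + ∫ s in 0..t, B (∫ r in 0..s, α r) (β s) := by
  have hsub : ∀ s ∈ Ioc 0 t, ∀ {H : Type _} [NormedAddCommGroup H] [NormedSpace ℝ H] (h : ℝ → H),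
      IntegrableOn h (Ioc 0 t) → IntervalIntegrable h volume 0 s := by
    intro s hs H _ _ h hh
    exact (intervalIntegrable_iff_integrableOn_Ioc_of_le hs.1.le).2
      (hh.mono_set (Ioc_subset_Ioc_right hs.2))
  -- Fubini for `B (α s) (β r)` on the triangle `s < r`: integrating first in `r` gives `B (α s)
  -- (∫ₛᵗ β)`, first in `s` gives `B (∫₀ʳ α) (β r)`.
  have hint : Integrable (fun z : ℝ × ℝ => {z : ℝ × ℝ | z.1 < z.2}.indicator
      (fun z => B (α z.1) (β z.2)) z)
      ((volume.restrict (Ioc 0 t)).prod (volume.restrict (Ioc 0 t))) := by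
    refine Integrable.indicator ?_ (measurableSet_lt measurable_fst measurable_snd)
    refine Integrable.op_fst_snd (op := fun x y => B x y) ?_
      ⟨‖B‖, fun x y => B.le_opNorm₂ x y⟩ hα hβ
    exact B.continuous₂
  have hswap := integral_integral_swap (f := fun s r => {z : ℝ × ℝ | z.1 < z.2}.indicator
      (fun z => B (α z.1) (β z.2)) (s, r)) hint
  have e1 : ∀ s ∈ Ioc 0 t, ∫ r in Ioc 0 t, {z : ℝ × ℝ | z.1 < z.2}.indicator
      (fun z => B (α z.1) (β z.2)) (s, r) = B (α s) (∫ r in s..t, β r) := by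
    intro s hs
    have : (fun r => {z : ℝ × ℝ | z.1 < z.2}.indicator (fun z => B (α z.1) (β z.2)) (s, r))
        = (Ioi s).indicator (fun r => B (α s) (β r)) := by
      ext r; simp [indicator]
    rw [this, setIntegral_indicator measurableSet_Ioi, intervalIntegral.integral_of_le hs.2,
      ← ContinuousLinearMap.integral_comp_comm]
    · congr 2
      ext r; simp only [mem_inter_iff, mem_Ioc, mem_Ioi]
      exact ⟨fun h => ⟨h.2, h.1.2⟩, fun h => ⟨⟨hs.1.trans h.1, h.2⟩, h.1⟩⟩
    · exact hβ.mono_set (Ioc_subset_Ioc_left hs.1.le)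
  have e2 : ∀ r ∈ Ioc 0 t, ∫ s in Ioc 0 t, {z : ℝ × ℝ | z.1 < z.2}.indicator
      (fun z => B (α z.1) (β z.2)) (s, r) = B (∫ s in 0..r, α s) (β r) := by
    intro r hr
    have : (fun s => {z : ℝ × ℝ | z.1 < z.2}.indicator (fun z => B (α z.1) (β z.2)) (s, r))
        = (Iio r).indicator (fun s => B.flip (β r) (α s)) := by
      ext s; simp [indicator]
    rw [this, setIntegral_indicator measurableSet_Iio, intervalIntegral.integral_of_le hr.1.le,
      ← ContinuousLinearMap.flip_apply B, ← ContinuousLinearMap.integral_comp_comm]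
    -- The strict inequality `s < r` makes the slice open at `r`, which costs nothing for Lebesgue
    -- measure.
    · rw [integral_Ioc_eq_integral_Ioo]
      congr 2
      ext s; simp only [mem_inter_iff, mem_Ioc, mem_Iio, mem_Ioo]
      exact ⟨fun h => ⟨h.1.1, h.2⟩, fun h => ⟨⟨h.1, h.2.le.trans hr.2⟩, h.2⟩⟩
    · exact hα.mono_set (Ioc_subset_Ioc_right hr.2)
  rw [setIntegral_congr_fun measurableSet_Ioc e1, setIntegral_congr_fun measurableSet_Ioc e2]
    at hswap
  rw [intervalIntegral.integral_of_le ht (f := fun s => B (∫ r in 0..s, α r) (β s)), ← hswap,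
    intervalIntegral.integral_of_le ht (f := fun s => B (α s) (b + ∫ r in 0..s, β r)),
    ← integral_add (integrableOn_bilin_primitive B hα hβ b)]
  -- For fixed `s` the integrals of `β` over `(0, s]` and `(s, t]` recombine, so the second argument
  -- no longer depends on `s`.
  · have : ∀ s ∈ Ioc 0 t, B (α s) (b + ∫ r in 0..s, β r) + B (α s) (∫ r in s..t, β r)
        = B.flip (b + ∫ s in 0..t, β s) (α s) := by
      intro s hs
      rw [← map_add, add_assoc, intervalIntegral.integral_add_adjacent_intervals (hsub s hs β hβ)]
      · rfl
      · exact (intervalIntegrable_iff_integrableOn_Ioc_of_le hs.2).2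
          (hβ.mono_set (Ioc_subset_Ioc_left hs.1.le))
    rw [setIntegral_congr_fun measurableSet_Ioc this, ContinuousLinearMap.integral_comp_comm _ hα,
      intervalIntegral.integral_of_le ht]
    rfl
  · refine hint.integral_prod_left.congr ?_
    filter_upwards [ae_restrict_mem measurableSet_Ioc] with s hs using e1 s hs

end Primitive

/-! ### Weak derivatives in time -/

section WeakDerivative

/-- A test function with vanishing integral is the derivative of a test function. -/
lemma exists_testFunction_deriv_eq {T : ℝ} {χ : ℝ → ℝ} (hc : ContDiff ℝ (⊤ : ℕ∞) χ)
    (hK : HasCompactSupport χ) (hsub : tsupport χ ⊆ Ioo 0 T) (h0 : ∫ t, χ t = 0) :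
    ∃ φ : 𝓓((⟨Ioo 0 T, isOpen_Ioo⟩ : Opens ℝ), ℝ), ∀ t, deriv (fun s => φ s) t = χ t := by
  rcases (tsupport χ).eq_empty_or_nonempty with he | hne
  · have : χ = 0 := tsupport_eq_empty_iff.1 he
    exact ⟨0, fun t => by rw [this]; simp⟩
  obtain ⟨a, ha, ha'⟩ := hK.isCompact.exists_isLeast hne
  obtain ⟨b, hb, hb'⟩ := hK.isCompact.exists_isGreatest hne
  have hz : ∀ t, t ∉ Icc a b → χ t = 0 := fun t ht => by
    by_contra hn
    exact ht ⟨ha' (subset_tsupport _ hn), hb' (subset_tsupport _ hn)⟩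
  have hd : ∀ t, HasDerivAt (fun t => ∫ s in a..t, χ s) (χ t) t := fun t =>
    hc.continuous.integral_hasStrictDerivAt a t |>.hasDerivAt
  have hsm : ContDiff ℝ (⊤ : ℕ∞) (fun t => ∫ s in a..t, χ s) := by
    refine contDiff_infty_iff_deriv.2 ⟨fun t => (hd t).differentiableAt, ?_⟩
    rwa [show deriv (fun t => ∫ s in a..t, χ s) = χ from funext fun t => (hd t).deriv]
  have hi : Integrable χ := hc.continuous.integrable_of_hasCompactSupport hK
  -- Left of the support the integrand vanishes almost everywhere; right of it the integral is the
  -- total integral of `χ`, which is zero.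
  have hout : ∀ t, t ∉ Icc a b → ∫ s in a..t, χ s = 0 := by
    intro t ht
    rcases lt_or_ge t a with hta | hta
    · refine intervalIntegral.integral_zero_ae ?_
      have : ∀ᵐ x : ℝ, x ≠ a := by simp [ae_iff]
      filter_upwards [this] with x hx hxm
      rw [uIoc_of_ge hta.le] at hxm
      exact hz x fun h => hx (le_antisymm hxm.2 h.1)
    · have htb : b < t := lt_of_not_ge fun h => ht ⟨hta, h⟩
      rw [intervalIntegral.integral_of_le hta, ← integral_Icc_eq_integral_Ioc,
        setIntegral_eq_integral_of_forall_compl_eq_zero, h0]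
      exact fun x hx => hz x fun h => hx ⟨h.1, h.2.trans htb.le⟩
  have hts : tsupport (fun t => ∫ s in a..t, χ s) ⊆ Icc a b :=
    closure_minimal (fun t ht => by
      by_contra hn
      exact ht (hout t hn)) isClosed_Icc
  refine ⟨⟨fun t => ∫ s in a..t, χ s, hsm, ?_, ?_⟩, fun t => (hd t).deriv⟩
  · exact isCompact_Icc.of_isClosed_subset (isClosed_tsupport _) hts
  · exact hts.trans fun t ht => ⟨(hsub ha).1.trans_le ht.1, ht.2.trans_lt (hsub hb).2⟩

variable {F : Type*} [NormedAddCommGroup F] [NormedSpace ℝ F] [CompleteSpace F]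

/-- The du Bois-Reymond lemma. -/
lemma ae_eq_const_of_integral_deriv_smul {T : ℝ} (hT : 0 < T) {z : ℝ → F}
    (hz : IntegrableOn z (Ioc 0 T))
    (h : ∀ φ : 𝓓((⟨Ioo 0 T, isOpen_Ioo⟩ : Opens ℝ), ℝ),
      ∫ t in 0..T, deriv (fun s => φ s) t • z t = 0) :
    ∃ c, ∀ᵐ t ∂(volume.restrict (Icc 0 T)), z t = c := by
  -- The radii keep the support `[T/4, 3T/4]` inside `(0, T)`.
  let bump : ContDiffBump (T / 2) := ⟨T / 8, T / 4, by linarith, by linarith⟩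
  set ρ : ℝ → ℝ := bump.normed volume with hρ
  have ρc : ContDiff ℝ (⊤ : ℕ∞) ρ := bump.contDiff_normed
  have ρK : HasCompactSupport ρ := bump.hasCompactSupport_normed
  have ρs : tsupport ρ ⊆ Ioo 0 T := by
    rw [hρ, bump.tsupport_normed_eq, Real.closedBall_eq_Icc]
    intro x hx
    simp only [bump, mem_Icc] at hx
    exact ⟨by linarith [hx.1], by linarith [hx.2]⟩
  have hsmul : ∀ {ψ : ℝ → ℝ}, Continuous ψ → IntegrableOn (fun t => ψ t • z t) (Ioc 0 T) := by
    intro ψ hψ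
    have := (integrableOn_Icc_iff_integrableOn_Ioc).2 hz
    exact (this.continuousOn_smul hψ.continuousOn isCompact_Icc).mono_set Ioc_subset_Icc_self
  -- If `z` is constant, averaging against `ρ`, which has integral one, recovers the constant.
  set c := ∫ t in Ioc 0 T, ρ t • z t with hcdef
  have hloc : LocallyIntegrableOn (fun t => z t - c) (Ioo 0 T) volume := by
    have : IntegrableOn (fun t => z t - c) (Ioc 0 T) := hz.sub (by simp)
    exact (this.mono_set Ioo_subset_Ioc_self).locallyIntegrableOn
  have key := isOpen_Ioo.ae_eq_zero_of_integral_contDiff_smul_eq_zero hloc fun ψ h1 h2 h3 => by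
    have ψi : Integrable ψ := h1.continuous.integrable_of_hasCompactSupport h2
    have ρi : Integrable ρ := ρc.continuous.integrable_of_hasCompactSupport ρK
    set m := ∫ t, ψ t with hm
    have hsup : tsupport (fun t => ψ t - m * ρ t) ⊆ tsupport ψ ∪ tsupport ρ := by
      refine (closure_mono ?_).trans (closure_union).subset
      intro t ht
      by_contra hn
      simp only [mem_union, Function.mem_support, not_or, not_not] at hn
      exact ht (by simp [hn.1, hn.2])
    -- Subtracting `(∫ ψ) ρ` makes the integral vanish, so the difference is an admissible `φ'`.
    obtain ⟨φ, hφ⟩ := exists_testFunction_deriv_eq (T := T) (χ := fun t => ψ t - m * ρ t)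
      (h1.sub (contDiff_const.mul ρc))
      ((h2.isCompact.union ρK.isCompact).of_isClosed_subset (isClosed_tsupport _) hsup)
      (hsup.trans (union_subset h3 ρs)) (by
        rw [integral_sub ψi (ρi.const_mul m), integral_const_mul, bump.integral_normed]
        ring)
    have e := h φ
    simp only [hφ] at e
    rw [intervalIntegral.integral_of_le hT.le] at e
    simp only [sub_smul, mul_smul] at e
    rw [integral_sub (g := fun t => m • ρ t • z t) (hsmul h1.continuous)
      ((hsmul ρc.continuous).smul m), integral_smul,
      ← hcdef, sub_eq_zero] at e
    have hψ0 : ∀ t, t ∉ Ioc 0 T → ψ t = 0 := fun t ht => by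
      by_contra hn
      exact ht (Ioo_subset_Ioc_self (h3 (subset_tsupport _ hn)))
    rw [← setIntegral_eq_integral_of_forall_compl_eq_zero (s := Ioc 0 T)
      (fun t ht => by simp [hψ0 t ht])]
    simp only [smul_sub]
    rw [integral_sub (hsmul h1.continuous) ((ψi.smul_const c).integrableOn), e,
      integral_smul_const, setIntegral_eq_integral_of_forall_compl_eq_zero hψ0, sub_self]
  refine ⟨c, ?_⟩
  rw [← Measure.restrict_congr_set Ioo_ae_eq_Icc]
  refine (ae_restrict_iff' measurableSet_Ioo).2 ?_
  filter_upwards [key] with t ht hm using sub_eq_zero.1 (ht hm)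

/-- A function with an integrable weak derivative is almost everywhere a primitive. -/
theorem HasWeakTimeDeriv.exists_eq_primitive {T : ℝ} (hT : 0 < T) {y y' : ℝ → F}
    (hy : IntegrableOn y (Icc 0 T)) (hy' : IntegrableOn y' (Icc 0 T))
    (h : HasWeakTimeDeriv T y y') :
    ∃ c, ∀ᵐ t ∂(volume.restrict (Icc 0 T)), y t = c + ∫ s in 0..t, y' s := by
  rw [integrableOn_Icc_iff_integrableOn_Ioc] at hy hy'
  have hY : IntegrableOn (fun t => (0 : F) + ∫ s in 0..t, y' s) (Ioc 0 T) :=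
    ((continuousOn_add_primitive hy' 0).integrableOn_Icc).mono_set Ioc_subset_Icc_self
  simp only [zero_add] at hY
  -- The difference of `y` and the primitive of `y'` has weak derivative zero.
  have := ae_eq_const_of_integral_deriv_smul hT (hy.sub hY) fun φ => by
    have dc : Continuous (deriv fun s => φ s) :=
      φ.contDiff.continuous_deriv (by simp)
    have dK : HasCompactSupport (deriv fun s => φ s) := φ.hasCompactSupport.deriv
    have di : IntegrableOn (deriv fun s => φ s) (Ioc 0 T) :=
      (dc.integrable_of_hasCompactSupport dK).integrableOn
    have hsmul : ∀ {w : ℝ → F}, IntegrableOn w (Ioc 0 T) →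
        IntegrableOn (fun t => deriv (fun s => φ s) t • w t) (Ioc 0 T) := by
      intro w hw
      have := (integrableOn_Icc_iff_integrableOn_Ioc).2 hw
      exact (this.continuousOn_smul dc.continuousOn isCompact_Icc).mono_set Ioc_subset_Icc_self
    have hz : ∀ t, t ∉ Ioo 0 T → φ t = 0 := fun t ht => by
      by_contra hn
      exact ht (φ.tsupport_subset (subset_tsupport _ hn))
    have hprim : ∀ t, ∫ s in 0..t, deriv (fun s => φ s) s = φ t := fun t => by
      rw [intervalIntegral.integral_deriv_eq_sub (fun x _ =>
        φ.contDiff.differentiable (by simp) x) (dc.intervalIntegrable _ _), hz 0 (by simp), sub_zero]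
    -- Product rule for `φ` and the primitive of `y'`; the boundary term disappears because `φ`
    -- vanishes at `0` and `T`.
    have e := bilin_primitive (ContinuousLinearMap.lsmul ℝ ℝ : ℝ →L[ℝ] F →L[ℝ] F) hT.le di hy' 0
    simp only [hprim, zero_add, ContinuousLinearMap.lsmul_apply, hz T (by simp), zero_smul] at e
    have e' := h φ
    simp only [Pi.sub_apply, smul_sub]
    rw [intervalIntegral.integral_of_le hT.le] at e e' ⊢
    rw [integral_sub (hsmul hy) (hsmul hY), e', intervalIntegral.integral_of_le hT.le]
    rw [intervalIntegral.integral_of_le hT.le] at e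
    rw [← neg_add', add_comm, ← e, neg_zero]
  obtain ⟨c, hc⟩ := this
  refine ⟨c, ?_⟩
  filter_upwards [hc] with t ht
  rw [← ht]
  simp

end WeakDerivative

/-! ### Regularization and the product rule in a Gelfand triple -/

section InnerBilin

/-- The inner product of a real Hilbert space as a continuous bilinear map. -/
def innerBilin (V : Type*) [NormedAddCommGroup V] [InnerProductSpace ℝ V] :
    V →L[ℝ] V →L[ℝ] ℝ := innerSL ℝ

@[simp] lemma innerBilin_apply {V : Type*} [NormedAddCommGroup V] [InnerProductSpace ℝ V]
    (v w : V) : innerBilin V v w = inner ℝ v w := rfl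

end InnerBilin

section Regularization

variable {V H : Type*} [NormedAddCommGroup V] [InnerProductSpace ℝ V] [CompleteSpace V]
  [NormedAddCommGroup H] [InnerProductSpace ℝ H] [CompleteSpace H]

/-- The form `(v, w) ↦ ⟨Jv, Jw⟩ + ε ⟨v, w⟩`. -/
def regForm (J : V →L[ℝ] H) (ε : ℝ) : V →L[ℝ] V →L[ℝ] ℝ :=
  innerBilin V ∘L ((adjoint J ∘L J) + ε • ContinuousLinearMap.id ℝ V)

lemma regForm_apply (J : V →L[ℝ] H) (ε : ℝ) (v w : V) :
    regForm J ε v w = inner ℝ (J v) (J w) + ε * inner ℝ v w := by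
  simp [regForm, adjoint_inner_left]

/-- The term `ε ‖v‖²` supplies coercivity, so Lax–Milgram inverts `J†J + ε`. -/
lemma isCoercive_regForm (J : V →L[ℝ] H) {ε : ℝ} (hε : 0 < ε) : IsCoercive (regForm J ε) := by
  refine ⟨ε, hε, fun v => ?_⟩
  rw [regForm_apply, real_inner_self_eq_norm_sq, real_inner_self_eq_norm_sq]
  nlinarith [sq_nonneg ‖J v‖]

/-- The inverse of `J†J + ε`. -/
def regInv (J : V →L[ℝ] H) {ε : ℝ} (hε : 0 < ε) : V →L[ℝ] V :=
  ((isCoercive_regForm J hε).continuousLinearEquivOfBilin.symm : V →L[ℝ] V)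

lemma inner_regInv (J : V →L[ℝ] H) {ε : ℝ} (hε : 0 < ε) (x w : V) :
    inner ℝ (J (regInv J hε x)) (J w) + ε * inner ℝ (regInv J hε x) w = inner ℝ x w := by
  rw [← regForm_apply, ← (isCoercive_regForm J hε).continuousLinearEquivOfBilin_apply]
  simp [regInv]

lemma regInv_symm (J : V →L[ℝ] H) {ε : ℝ} (hε : 0 < ε) (x y : V) :
    inner ℝ (regInv J hε x) y = inner ℝ x (regInv J hε y) := by
  rw [real_inner_comm, ← inner_regInv J hε y, ← inner_regInv J hε x, real_inner_comm,
    real_inner_comm (regInv J hε x)]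

/-- The defect `v - (J†J + ε)⁻¹ J†J v`. -/
def regDefect (J : V →L[ℝ] H) {ε : ℝ} (hε : 0 < ε) : V →L[ℝ] V :=
  ContinuousLinearMap.id ℝ V - regInv J hε ∘L (adjoint J ∘L J)

lemma regInv_adjoint (J : V →L[ℝ] H) {ε : ℝ} (hε : 0 < ε) (v : V) :
    regInv J hε (adjoint J (J v)) = v - regDefect J hε v := by
  simp [regDefect]

/-- The defect is `ε (J†J + ε)⁻¹ v`; this is its weak equation, from which both bounds below follow
by testing with the defect itself. -/
lemma inner_regDefect (J : V →L[ℝ] H) {ε : ℝ} (hε : 0 < ε) (v w : V) :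
    inner ℝ (J (regDefect J hε v)) (J w) + ε * inner ℝ (regDefect J hε v) w
      = ε * inner ℝ v w := by
  have := inner_regInv J hε (adjoint J (J v)) w
  rw [regInv_adjoint, map_sub, inner_sub_left, inner_sub_left, adjoint_inner_left] at this
  linarith

lemma norm_regDefect_le (J : V →L[ℝ] H) {ε : ℝ} (hε : 0 < ε) (v : V) :
    ‖regDefect J hε v‖ ≤ ‖v‖ := by
  have h := inner_regDefect J hε v (regDefect J hε v)
  rw [real_inner_self_eq_norm_sq, real_inner_self_eq_norm_sq] at h
  have h2 := real_inner_le_norm v (regDefect J hε v)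
  set e := regDefect J hε v
  have h3 : ‖e‖ ^ 2 ≤ ‖v‖ * ‖e‖ := by
    have : ε * ‖e‖ ^ 2 ≤ ε * (‖v‖ * ‖e‖) := by
      nlinarith [sq_nonneg ‖J e‖]
    exact le_of_mul_le_mul_left this hε
  by_contra hn
  push Not at hn
  nlinarith [norm_nonneg v, norm_nonneg e]

/-- On the range of `J†J` the defect `e` is of order `√ε`: testing gives `‖J e‖² + ε ‖e‖² = ε ⟨J w,
J e⟩`, and completing the square absorbs `‖J e‖`. -/
lemma norm_regDefect_adjoint_le (J : V →L[ℝ] H) {ε : ℝ} (hε : 0 < ε) (w : V) :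
    ‖regDefect J hε (adjoint J (J w))‖ ^ 2 ≤ ε * ‖J w‖ ^ 2 := by
  have h := inner_regDefect J hε (adjoint J (J w)) (regDefect J hε (adjoint J (J w)))
  rw [real_inner_self_eq_norm_sq, real_inner_self_eq_norm_sq, adjoint_inner_left] at h
  set e := regDefect J hε (adjoint J (J w))
  have h2 := real_inner_le_norm (J w) (J e)
  have : ε * ‖e‖ ^ 2 ≤ ε * (ε * ‖J w‖ ^ 2) := by
    have h3 := mul_le_mul_of_nonneg_left h2 hε.le
    nlinarith [sq_nonneg (‖J e‖ - ε * ‖J w‖), sq_nonneg (ε * ‖J w‖), sq_nonneg (‖J e‖)]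
  exact le_of_mul_le_mul_left this hε

/-- A vector `x` orthogonal to the range satisfies `‖J x‖² = ⟨J†J x, x⟩ = 0`. -/
lemma dense_range_adjoint_comp {J : V →L[ℝ] H} (hJ : Function.Injective J) :
    Dense (range fun w => adjoint J (J w)) := by
  have : ((adjoint J ∘L J).range)ᗮ = ⊥ := by
    rw [Submodule.eq_bot_iff]
    intro x hx
    have := hx (adjoint J (J x)) ⟨x, rfl⟩
    rw [adjoint_inner_left, inner_self_eq_zero] at this
    exact hJ (by rw [this, map_zero])
  have := (Submodule.topologicalClosure_eq_top_iff).2 this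
  exact Submodule.dense_iff_topologicalClosure_eq_top.2 this

/-- Strong convergence from convergence on the dense range of `J†J` and the uniform bound
`‖regDefect v‖ ≤ ‖v‖`. -/
lemma tendsto_regDefect {J : V →L[ℝ] H} (hJ : Function.Injective J) {ε : ℕ → ℝ}
    (hε : ∀ n, 0 < ε n) (h0 : Tendsto ε atTop (𝓝 0)) (v : V) :
    Tendsto (fun n => regDefect J (hε n) v) atTop (𝓝 0) := by
  rw [Metric.tendsto_atTop]
  intro δ hδ
  obtain ⟨x, ⟨w, rfl⟩, hw⟩ := Metric.mem_closure_iff.1 (dense_range_adjoint_comp hJ v) (δ / 2)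
    (by positivity)
  have : Tendsto (fun n => ε n * ‖J w‖ ^ 2) atTop (𝓝 0) := by
    simpa using h0.mul_const (‖J w‖ ^ 2)
  obtain ⟨N, hN⟩ := (Metric.tendsto_atTop.1 this) ((δ / 2) ^ 2) (by positivity)
  refine ⟨N, fun n hn => ?_⟩
  rw [dist_zero_right]
  have h1 := hN n hn
  rw [Real.dist_0_eq_abs] at h1
  have h2 := (norm_regDefect_adjoint_le J (hε n) w).trans_lt ((le_abs_self _).trans_lt h1)
  have h3 := lt_of_pow_lt_pow_left₀ 2 (by positivity) h2
  have h4 := norm_regDefect_le J (hε n) (v - adjoint J (J w))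
  rw [← dist_eq_norm] at h4
  calc ‖regDefect J (hε n) v‖
      = ‖regDefect J (hε n) (v - adjoint J (J w)) + regDefect J (hε n) (adjoint J (J w))‖ := by
        rw [← map_add, sub_add_cancel]
    _ ≤ _ := norm_add_le _ _
    _ < δ := by linarith

lemma tendsto_regInv_adjoint {J : V →L[ℝ] H} (hJ : Function.Injective J) {ε : ℕ → ℝ}
    (hε : ∀ n, 0 < ε n) (h0 : Tendsto ε atTop (𝓝 0)) (v : V) :
    Tendsto (fun n => regInv J (hε n) (adjoint J (J v))) atTop (𝓝 v) := by
  simp_rw [regInv_adjoint]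
  simpa using tendsto_const_nhds.sub (tendsto_regDefect hJ hε h0 v)

lemma norm_regInv_adjoint_le (J : V →L[ℝ] H) {ε : ℝ} (hε : 0 < ε) (v : V) :
    ‖regInv J hε (adjoint J (J v))‖ ≤ 2 * ‖v‖ := by
  rw [regInv_adjoint, two_mul]
  exact (norm_sub_le _ _).trans (add_le_add_right (norm_regDefect_le J hε v) _)

lemma tendsto_integral_inner_regInv {J : V →L[ℝ] H} (hJ : Function.Injective J) {ε : ℕ → ℝ}
    (hε : ∀ n, 0 < ε n) (h0 : Tendsto ε atTop (𝓝 0)) {μ : Measure ℝ} {x y : ℝ → V}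
    (hx : MemLp x 2 μ) (hy : MemLp y 2 μ) :
    Tendsto (fun n => ∫ s, inner ℝ (x s) (regInv J (hε n) (adjoint J (J (y s)))) ∂μ) atTop
      (𝓝 (∫ s, inner ℝ (x s) (y s) ∂μ)) := by
  refine tendsto_integral_of_dominated_convergence (fun s => 2 * (‖x s‖ * ‖y s‖)) ?_ ?_ ?_ ?_
  · intro n
    exact hx.1.inner ((regInv J (hε n) ∘L (adjoint J ∘L J)).continuous.comp_aestronglyMeasurable
      hy.1)
  · exact (hx.norm.integrable_mul hy.norm).const_mul 2
  · intro n
    refine Eventually.of_forall fun s => (norm_inner_le_norm _ _).trans ?_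
    calc ‖x s‖ * _ ≤ ‖x s‖ * (2 * ‖y s‖) := by gcongr; exact norm_regInv_adjoint_le J _ _
      _ = _ := by ring
  · exact Eventually.of_forall fun s =>
      tendsto_const_nhds.inner (tendsto_regInv_adjoint hJ hε h0 (y s))

/-- The product rule in a Gelfand triple `V ⊆ H ⊆ V*`, where `J : V → H` is the embedding and the
dual `V*` is identified with `V` by the Riesz isomorphism. -/
theorem inner_primitive_of_gelfand {J : V →L[ℝ] H} (hJ : Function.Injective J) {t : ℝ}
    (ht : 0 ≤ t) {y η ζ θ : ℝ → V} (hy : MemLp y 2 (volume.restrict (Ioc 0 t)))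
    (hη : MemLp η 2 (volume.restrict (Ioc 0 t))) (hζ : MemLp ζ 2 (volume.restrict (Ioc 0 t)))
    (hθ : MemLp θ 2 (volume.restrict (Ioc 0 t))) {c : V}
    (hyη : ∀ᵐ s ∂(volume.restrict (Ioc 0 t)), adjoint J (J (y s)) = ∫ r in 0..s, η r)
    (hζθ : ∀ᵐ s ∂(volume.restrict (Ioc 0 t)), adjoint J (J (ζ s)) = c + ∫ r in 0..s, θ r)
    (hζt : adjoint J (J (ζ t)) = c + ∫ r in 0..t, θ r) :
    inner ℝ (∫ s in 0..t, η s) (ζ t)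
      = (∫ s in 0..t, inner ℝ (η s) (ζ s)) + ∫ s in 0..t, inner ℝ (y s) (θ s) := by
  have hηi : IntegrableOn η (Ioc 0 t) := hη.integrable (by norm_num)
  have hθi : IntegrableOn θ (Ioc 0 t) := hθ.integrable (by norm_num)
  set ε : ℕ → ℝ := fun n => 1 / ((n : ℝ) + 1) with hεdef
  have hε : ∀ n, 0 < ε n := fun n => by positivity
  have h0 : Tendsto ε atTop (𝓝 0) := tendsto_one_div_add_atTop_nhds_zero_nat
  have key : ∀ n, inner ℝ (∫ s in 0..t, η s) (regInv J (hε n) (adjoint J (J (ζ t))))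
      = (∫ s in Ioc 0 t, inner ℝ (η s) (regInv J (hε n) (adjoint J (J (ζ s)))))
        + ∫ s in Ioc 0 t, inner ℝ (θ s) (regInv J (hε n) (adjoint J (J (y s)))) := by
    intro n
    -- The form `(x, y) ↦ ⟨(J†J + ε)⁻¹ x, y⟩` is continuous and symmetric on `V`, and both
    -- primitives live in `V`; symmetry moves the inverse onto whichever factor is of the form
    -- `J†J`.
    have e := bilin_primitive (innerBilin V ∘L regInv J (hε n)) ht hηi hθi c
    simp only [ContinuousLinearMap.comp_apply, innerBilin_apply] at e
    rw [← regInv_symm, hζt, e, intervalIntegral.integral_of_le ht,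
      intervalIntegral.integral_of_le ht]
    congr 1
    · refine integral_congr_ae ?_
      filter_upwards [hζθ] with s hs
      rw [← hs, regInv_symm]
    · refine integral_congr_ae ?_
      filter_upwards [hyη] with s hs
      rw [← hs, real_inner_comm]
  have lim1 := (tendsto_const_nhds (x := ∫ s in 0..t, η s)).inner (𝕜 := ℝ)
    (tendsto_regInv_adjoint hJ hε h0 (ζ t))
  have lim2 := (tendsto_integral_inner_regInv hJ hε h0 hη hζ).add
    (tendsto_integral_inner_regInv hJ hε h0 hθ hy)
  simp_rw [key] at lim1
  rw [tendsto_nhds_unique lim1 lim2, intervalIntegral.integral_of_le ht,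
    intervalIntegral.integral_of_le ht]
  simp_rw [real_inner_comm]

end Regularization

/-! ### Step functions and the Itô isometry -/

section SquareIntegrable

variable {α : Type*} [MeasurableSpace α] {μ : Measure α}
  {β : Type*} [MeasurableSpace β] {ν : Measure β}
  {E : Type*} [NormedAddCommGroup E] [InnerProductSpace ℝ E]

lemma memLp_smul_const {f : α → ℝ} (hf : MemLp f 2 μ) (c : E) :
    MemLp (fun x => f x • c) 2 μ :=
  (ContinuousLinearMap.toSpanSingleton ℝ c).comp_memLp' hf

lemma inner_toLp {f g : α → ℝ} (hf : MemLp f 2 μ) (hg : MemLp g 2 μ) :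
    inner ℝ (hf.toLp f) (hg.toLp g) = ∫ x, f x * g x ∂μ := by
  rw [L2.inner_def]
  refine integral_congr_ae ?_
  filter_upwards [hf.coeFn_toLp, hg.coeFn_toLp] with x h1 h2
  rw [h1, h2]
  simp [mul_comm]

lemma sq_integral_mul_le {f g : α → ℝ} (hf : MemLp f 2 μ) (hg : MemLp g 2 μ) :
    (∫ x, f x * g x ∂μ) ^ 2 ≤ (∫ x, f x ^ 2 ∂μ) * ∫ x, g x ^ 2 ∂μ := by
  have := real_inner_mul_inner_self_le (hf.toLp f) (hg.toLp g)
  rw [inner_toLp, inner_toLp, inner_toLp] at this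
  simpa only [pow_two] using this

lemma eLpNorm_two_eq_ofReal {f : α → E} (hf : MemLp f 2 μ) :
    eLpNorm f 2 μ = ENNReal.ofReal ((∫ x, ‖f x‖ ^ 2 ∂μ) ^ (2⁻¹ : ℝ)) := by
  rw [hf.eLpNorm_eq_integral_rpow_norm (by norm_num) (by norm_num)]
  simp

lemma integral_sq_le_of_eLpNorm_le {f : α → ℝ} {g : β → ℝ} (hf : MemLp f 2 μ) (hg : MemLp g 2 ν)
    (h : eLpNorm f 2 μ ≤ eLpNorm g 2 ν) : ∫ x, f x ^ 2 ∂μ ≤ ∫ x, g x ^ 2 ∂ν := by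
  have h1 : 0 ≤ ∫ x, ‖f x‖ ^ 2 ∂μ := integral_nonneg fun x => by positivity
  have h2 : 0 ≤ ∫ x, ‖g x‖ ^ 2 ∂ν := integral_nonneg fun x => by positivity
  rw [eLpNorm_two_eq_ofReal hf, eLpNorm_two_eq_ofReal hg,
    ENNReal.ofReal_le_ofReal_iff (by positivity),
    Real.rpow_le_rpow_iff h1 h2 (by norm_num)] at h
  simpa using h

/-- The norm depends on the `X i` only through their Gram matrix, so families on different measure
spaces with equal Gram matrices give equal norms. -/
lemma integral_norm_sq_sum_smul {n : ℕ} {X : Fin n → α → ℝ} (hX : ∀ i, MemLp (X i) 2 μ)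
    (c : Fin n → E) :
    ∫ x, ‖∑ i, X i x • c i‖ ^ 2 ∂μ = ∑ i, ∑ j, (∫ x, X i x * X j x ∂μ) * inner ℝ (c i) (c j) := by
  have : ∀ x, ‖∑ i, X i x • c i‖ ^ 2 = ∑ i, ∑ j, X i x * X j x * inner ℝ (c i) (c j) := by
    intro x
    rw [← real_inner_self_eq_norm_sq, sum_inner]
    refine Finset.sum_congr rfl fun i _ => ?_
    rw [inner_sum]
    refine Finset.sum_congr rfl fun j _ => ?_
    rw [real_inner_smul_left, real_inner_smul_right, mul_assoc]
  have hint : ∀ i j, Integrable (fun x => X i x * X j x * inner ℝ (c i) (c j)) μ := fun i j =>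
    ((hX i).integrable_mul (hX j)).mul_const _
  simp_rw [this]
  rw [integral_finsetSum _ fun i _ => integrable_finsetSum _ fun j _ => hint i j]
  refine Finset.sum_congr rfl fun i _ => ?_
  rw [integral_finsetSum _ fun j _ => hint i j]
  exact Finset.sum_congr rfl fun j _ => integral_mul_const _ _

/-- Serves both `U b = W b` on `Ω` and `U b = 1_{(0, b]}` on `(0, t]`: both have second moments `min
b c`, and this is the source of the Itô isometry. The bound by `t` is needed for the indicators. -/
lemma integral_mul_increments {U : ℝ≥0 → α → ℝ} {t : ℝ}
    (hU : ∀ b : ℝ≥0, (b : ℝ) ≤ t → MemLp (U b) 2 μ)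
    (hm : ∀ b c : ℝ≥0, (b : ℝ) ≤ t → (c : ℝ) ≤ t → ∫ x, U b x * U c x ∂μ = min b c)
    {a b c d : ℝ≥0} (ha : (a : ℝ) ≤ t) (hb : (b : ℝ) ≤ t) (hc : (c : ℝ) ≤ t) (hd : (d : ℝ) ≤ t) :
    ∫ x, (U b x - U a x) * (U d x - U c x) ∂μ
      = (min b d : ℝ≥0) - (min b c : ℝ≥0) - (min a d : ℝ≥0) + (min a c : ℝ≥0) := by
  have e : ∀ x, (U b x - U a x) * (U d x - U c x)
      = U b x * U d x - U b x * U c x - U a x * U d x + U a x * U c x := fun x => by ring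
  have i1 := (hU b hb).integrable_mul (hU d hd)
  have i2 := (hU b hb).integrable_mul (hU c hc)
  have i3 := (hU a ha).integrable_mul (hU d hd)
  have i4 := (hU a ha).integrable_mul (hU c hc)
  simp only [Pi.mul_def] at i1 i2 i3 i4
  simp_rw [e]
  have i12 : Integrable (fun x => U b x * U d x - U b x * U c x) μ := i1.sub i2
  have i123 : Integrable (fun x => U b x * U d x - U b x * U c x - U a x * U d x) μ := i12.sub i3
  rw [integral_add i123 i4, integral_sub i12 i3, integral_sub i1 i2,
    hm b d hb hd, hm b c hb hc, hm a d ha hd, hm a c ha hc]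

end SquareIntegrable

section Brownian

variable {Ω : Type*} [MeasurableSpace Ω] {P : Measure Ω} {W : ℝ≥0 → Ω → ℝ}

lemma memLp_brownian (hW : IsPreBrownianReal W P) (b : ℝ≥0) : MemLp (W b) 2 P :=
  (hW.isGaussianProcess.hasGaussianLaw_eval b).memLp_two

lemma integral_mul_brownian [IsProbabilityMeasure P] (hW : IsPreBrownianReal W P) (b c : ℝ≥0) :
    ∫ ω, W b ω * W c ω ∂P = min b c := by
  have := hW.covariance_eval b c
  rw [covariance_eq_sub (memLp_brownian hW b) (memLp_brownian hW c), hW.integral_eval,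
    zero_mul, sub_zero] at this
  exact this

end Brownian

namespace StepFunction

variable {E F : Type*} [NormedAddCommGroup E] [InnerProductSpace ℝ E]
  [NormedAddCommGroup F] [InnerProductSpace ℝ F]

/-- The sum of two step functions. -/
def add (S S' : StepFunction E) : StepFunction E where
  n := S.n + S'.n
  left := Fin.append S.left S'.left
  right := Fin.append S.right S'.right
  left_le_right := Fin.addCases (by simpa using S.left_le_right) (by simpa using S'.left_le_right)
  coef := Fin.append S.coef S'.coef

/-- A step function composed with a linear map. -/
def map (L : E →L[ℝ] F) (S : StepFunction E) : StepFunction F where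
  n := S.n
  left := S.left
  right := S.right
  left_le_right := S.left_le_right
  coef := fun i => L (S.coef i)

/-- The zero step function. -/
def zero (E : Type*) : StepFunction E where
  n := 0
  left := Fin.elim0
  right := Fin.elim0
  left_le_right := fun i => i.elim0
  coef := Fin.elim0

lemma eval_add (S S' : StepFunction E) (s : ℝ) : (S.add S').eval s = S.eval s + S'.eval s := by
  unfold eval
  change ∑ i : Fin (S.n + S'.n), _ = _
  rw [Fin.sum_univ_add]
  simp [add]

lemma eval_map (L : E →L[ℝ] F) (S : StepFunction E) (s : ℝ) :
    (S.map L).eval s = L (S.eval s) := by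
  unfold eval
  rw [map_sum]
  refine Finset.sum_congr rfl fun i _ => ?_
  by_cases h : s ∈ Ioc (S.left i : ℝ) (S.right i)
  · simp only [indicator_of_mem h]
    rw [indicator_of_mem (show s ∈ Ioc ((S.map L).left i : ℝ) ((S.map L).right i) from h)]
    rfl
  · simp only [indicator_of_notMem h, map_zero]
    rw [indicator_of_notMem (show s ∉ Ioc ((S.map L).left i : ℝ) ((S.map L).right i) from h)]

lemma eval_zero (s : ℝ) : (zero E).eval s = 0 := by
  unfold eval
  change ∑ i : Fin 0, _ = _
  simp

variable {Ω : Type*} {W : ℝ≥0 → Ω → ℝ}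

lemma integral_add (S S' : StepFunction E) (ω : Ω) :
    (S.add S').integral W ω = S.integral W ω + S'.integral W ω := by
  unfold integral
  change ∑ i : Fin (S.n + S'.n), _ = _
  rw [Fin.sum_univ_add]
  simp [add]

lemma integral_map (L : E →L[ℝ] F) (S : StepFunction E) (ω : Ω) :
    (S.map L).integral W ω = L (S.integral W ω) := by
  unfold integral
  rw [map_sum]
  refine Finset.sum_congr rfl fun i _ => ?_
  rw [map_smul]
  rfl

lemma integral_zero (ω : Ω) : (zero E).integral W ω = 0 := by
  unfold integral
  change ∑ i : Fin 0, _ = _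
  simp

lemma right_add_le {S S' : StepFunction E} {t : ℝ} (h : ∀ i, (S.right i : ℝ) ≤ t)
    (h' : ∀ i, (S'.right i : ℝ) ≤ t) : ∀ i, ((S.add S').right i : ℝ) ≤ t :=
  Fin.addCases (by simpa [add] using h) (by simpa [add] using h')

/-- The function `1_{(0, b]}`. -/
def unit (b : ℝ≥0) (s : ℝ) : ℝ := (Ioc 0 (b : ℝ)).indicator 1 s

/-- Gives a step function the shape of its elementary integral, with `1_{(0, b]}` in the place of `W
b`. -/
lemma eval_eq_sum_unit (S : StepFunction E) (s : ℝ) :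
    S.eval s = ∑ i, (unit (S.right i) s - unit (S.left i) s) • S.coef i := by
  refine Finset.sum_congr rfl fun i _ => ?_
  have h1 : (S.left i : ℝ) ≤ S.right i := S.left_le_right i
  have h2 : (0 : ℝ) ≤ S.left i := (S.left i).2
  simp only [unit, indicator, mem_Ioc, Pi.one_apply]
  by_cases h3 : (S.left i : ℝ) < s
  · have h5 : 0 < s := h2.trans_lt h3
    by_cases h4 : s ≤ S.right i
    · simp [h3, h4, h5, not_le.2 h3]
    · simp [h3, h4, h5, not_le.2 h3]
  · have h4 : s ≤ S.left i := not_lt.1 h3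
    have h6 : s ≤ S.right i := h4.trans h1
    simp [h3, h4, h6]

lemma measurable_unit (b : ℝ≥0) : Measurable (unit b) :=
  measurable_one.indicator measurableSet_Ioc

lemma memLp_unit (b : ℝ≥0) (t : ℝ) : MemLp (unit b) 2 (volume.restrict (Ioc 0 t)) := by
  refine MemLp.of_bound (measurable_unit b).aestronglyMeasurable 1
    (Eventually.of_forall fun s => ?_)
  unfold unit indicator
  split_ifs <;> simp

lemma integral_unit_mul_unit {b c : ℝ≥0} {t : ℝ} (hb : (b : ℝ) ≤ t) (hc : (c : ℝ) ≤ t) :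
    ∫ s in Ioc 0 t, unit b s * unit c s = (min b c : ℝ≥0) := by
  have : ∀ s, unit b s * unit c s = (Ioc 0 ((min b c : ℝ≥0) : ℝ)).indicator 1 s := by
    intro s
    rw [unit, unit, ← inter_indicator_mul, Ioc_inter_Ioc]
    simp [indicator]
  simp_rw [this]
  rw [integral_indicator_one measurableSet_Ioc, measureReal_restrict_apply measurableSet_Ioc,
    Ioc_inter_Ioc]
  have h1 : min ((min b c : ℝ≥0) : ℝ) t = (min b c : ℝ≥0) := by
    refine min_eq_left (le_trans ?_ hb)
    exact_mod_cast min_le_left b c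
  rw [h1, max_self, Real.volume_real_Ioc_of_le (NNReal.coe_nonneg _), sub_zero]

lemma memLp_eval (S : StepFunction E) (t : ℝ) :
    MemLp S.eval 2 (volume.restrict (Ioc 0 t)) := by
  have : S.eval = fun s => ∑ i, (unit (S.right i) s - unit (S.left i) s) • S.coef i :=
    funext S.eval_eq_sum_unit
  rw [this]
  exact memLp_finsetSum _ fun i _ => memLp_smul_const ((memLp_unit _ t).sub (memLp_unit _ t)) _

variable [MeasurableSpace Ω] {P : Measure Ω}

lemma memLp_integral (hW : IsPreBrownianReal W P) (S : StepFunction E) :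
    MemLp (S.integral W) 2 P :=
  memLp_finsetSum _ fun i _ =>
    memLp_smul_const ((memLp_brownian hW _).sub (memLp_brownian hW _)) _

/-- The Itô isometry for step functions. -/
theorem eLpNorm_integral [IsProbabilityMeasure P] (hW : IsPreBrownianReal W P)
    (S : StepFunction E) {t : ℝ} (h : ∀ i, (S.right i : ℝ) ≤ t) :
    eLpNorm (S.integral W) 2 P = eLpNorm S.eval 2 (volume.restrict (Ioc 0 t)) := by
  have h' : ∀ i, (S.left i : ℝ) ≤ t := fun i => le_trans (S.left_le_right i) (h i)
  rw [eLpNorm_two_eq_ofReal (S.memLp_integral hW), eLpNorm_two_eq_ofReal (S.memLp_eval t)]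
  congr 2
  simp_rw [eval_eq_sum_unit]
  unfold integral
  rw [integral_norm_sq_sum_smul
      (X := fun i ω => W (S.right i) ω - W (S.left i) ω) (fun i => (memLp_brownian hW _).sub (memLp_brownian hW _)),
    integral_norm_sq_sum_smul
      (X := fun i s => unit (S.right i) s - unit (S.left i) s)
      (fun _ => (memLp_unit _ t).sub (memLp_unit _ t))]
  refine Finset.sum_congr rfl fun i _ => Finset.sum_congr rfl fun j _ => ?_
  congr 1
  -- The two Gram matrices coincide entry by entry.
  rw [integral_mul_increments (fun b _ => memLp_unit b t)
    (fun b c hb hc => integral_unit_mul_unit hb hc) (h' i) (h i) (h' j) (h j)]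
  exact integral_mul_increments (t := t) (fun b _ => memLp_brownian hW b)
    (fun b c _ _ => integral_mul_brownian hW b c) (h' i) (h i) (h' j) (h j)

end StepFunction

/-! ### Linearity, uniqueness and truncation of Wiener integrals -/

namespace IsWienerIntegral

variable {Ω : Type*} [MeasurableSpace Ω] {P : Measure Ω} {W : ℝ≥0 → Ω → ℝ}
  {E F : Type*} [NormedAddCommGroup E] [InnerProductSpace ℝ E]
  [NormedAddCommGroup F] [InnerProductSpace ℝ F] {t : ℝ} {B B' : ℝ → E} {I I' : Ω → E}

lemma congr (h : IsWienerIntegral P W t B I)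
    (hB : B =ᵐ[volume.restrict (Ioc 0 t)] B') (hI : I =ᵐ[P] I') : IsWienerIntegral P W t B' I' := by
  obtain ⟨S, h1, h2, h3⟩ := h.approx
  refine ⟨(memLp_congr_ae hI).1 h.memLp, S, h1, ?_, ?_⟩
  · refine h2.congr fun k => eLpNorm_congr_ae ?_
    filter_upwards [hB] with s hs
    rw [hs]
  · refine h3.congr fun k => eLpNorm_congr_ae ?_
    filter_upwards [hI] with s hs
    rw [hs]

lemma tendsto_eLpNorm_map {α : Type*} [MeasurableSpace α] {μ : Measure α} (L : E →L[ℝ] F)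
    {f : ℕ → α → E} (h : Tendsto (fun k => eLpNorm (f k) 2 μ) atTop (𝓝 0)) :
    Tendsto (fun k => eLpNorm (fun x => L (f k x)) 2 μ) atTop (𝓝 0) := by
  have h0 : Tendsto (fun k => ENNReal.ofReal ‖L‖ * eLpNorm (f k) 2 μ) atTop (𝓝 0) := by
    simpa using ENNReal.Tendsto.const_mul (a := ENNReal.ofReal ‖L‖) h
      (Or.inr ENNReal.ofReal_ne_top)
  exact tendsto_of_tendsto_of_tendsto_of_le_of_le tendsto_const_nhds h0 (fun _ => zero_le)
    fun k => eLpNorm_le_mul_eLpNorm_of_ae_le_mul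
      (Eventually.of_forall fun x => L.le_opNorm (f k x)) 2

lemma map (h : IsWienerIntegral P W t B I) (L : E →L[ℝ] F) :
    IsWienerIntegral P W t (fun s => L (B s)) (fun ω => L (I ω)) := by
  obtain ⟨S, h1, h2, h3⟩ := h.approx
  refine ⟨L.comp_memLp' h.memLp, fun k => (S k).map L, h1, ?_, ?_⟩
  · simpa only [StepFunction.eval_map, map_sub] using tendsto_eLpNorm_map L h2
  · simpa only [StepFunction.integral_map, map_sub] using tendsto_eLpNorm_map L h3

lemma add (hW : IsPreBrownianReal W P) (hB : AEStronglyMeasurable B (volume.restrict (Ioc 0 t)))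
    (hB' : AEStronglyMeasurable B' (volume.restrict (Ioc 0 t)))
    (h : IsWienerIntegral P W t B I) (h' : IsWienerIntegral P W t B' I') :
    IsWienerIntegral P W t (fun s => B s + B' s) (fun ω => I ω + I' ω) := by
  obtain ⟨S, h1, h2, h3⟩ := h.approx
  obtain ⟨S', h1', h2', h3'⟩ := h'.approx
  refine ⟨h.memLp.add h'.memLp, fun k => (S k).add (S' k),
    fun k => StepFunction.right_add_le (h1 k) (h1' k), ?_, ?_⟩
  · have := h2.add h2'
    rw [add_zero] at this
    refine tendsto_of_tendsto_of_tendsto_of_le_of_le tendsto_const_nhds this (fun _ => zero_le)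
      fun k => ?_
    refine le_trans (eLpNorm_congr_ae (Eventually.of_forall fun s => ?_)).le
      (eLpNorm_add_le (((S k).memLp_eval t).1.sub hB) (((S' k).memLp_eval t).1.sub hB')
        (by norm_num))
    simp only [StepFunction.eval_add, Pi.add_apply]
    abel
  · have := h3.add h3'
    rw [add_zero] at this
    refine tendsto_of_tendsto_of_tendsto_of_le_of_le tendsto_const_nhds this (fun _ => zero_le)
      fun k => ?_
    refine le_trans (eLpNorm_congr_ae (Eventually.of_forall fun s => ?_)).le
      (eLpNorm_add_le (((S k).memLp_integral hW).sub h.memLp).1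
        (((S' k).memLp_integral hW).sub h'.memLp).1 (by norm_num))
    simp only [StepFunction.integral_add, Pi.add_apply]
    abel

/-- One half of the Itô isometry. -/
lemma eLpNorm_le [IsProbabilityMeasure P] (hW : IsPreBrownianReal W P)
    (hB : AEStronglyMeasurable B (volume.restrict (Ioc 0 t))) (h : IsWienerIntegral P W t B I) :
    eLpNorm I 2 P ≤ eLpNorm B 2 (volume.restrict (Ioc 0 t)) := by
  obtain ⟨S, h1, h2, h3⟩ := h.approx
  have lim := (h3.add h2).add_const (eLpNorm B 2 (volume.restrict (Ioc 0 t)))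
  rw [add_zero, zero_add] at lim
  refine ge_of_tendsto' lim fun k => ?_
  have a1 : eLpNorm I 2 P ≤ eLpNorm (fun ω => (S k).integral W ω - I ω) 2 P
      + eLpNorm ((S k).integral W) 2 P := by
    have := eLpNorm_sub_le ((S k).memLp_integral hW).1
      (((S k).memLp_integral hW).sub h.memLp).1 (p := 2) (by norm_num)
    rw [sub_sub_cancel, add_comm] at this
    exact this
  have a2 : eLpNorm (S k).eval 2 (volume.restrict (Ioc 0 t))
      ≤ eLpNorm (fun s => (S k).eval s - B s) 2 (volume.restrict (Ioc 0 t))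
        + eLpNorm B 2 (volume.restrict (Ioc 0 t)) := by
    have := eLpNorm_add_le (((S k).memLp_eval t).1.sub hB) hB (p := 2) (by norm_num)
    rw [sub_add_cancel] at this
    exact this
  rw [StepFunction.eLpNorm_integral hW _ (h1 k)] at a1
  calc _ ≤ _ := a1
    _ ≤ _ := by rw [add_assoc]; gcongr

/-- The difference is a Wiener integral of zero, hence has norm zero by the isometry bound. -/
lemma unique [IsProbabilityMeasure P] (hW : IsPreBrownianReal W P)
    (hB : AEStronglyMeasurable B (volume.restrict (Ioc 0 t)))
    (h : IsWienerIntegral P W t B I) (h' : IsWienerIntegral P W t B I') : I =ᵐ[P] I' := by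
  have hn : IsWienerIntegral P W t (fun s => - B s) (fun ω => - I' ω) := by
    simpa using h'.map (-ContinuousLinearMap.id ℝ E)
  have hs := h.add hW hB hB.neg hn
  have hle := hs.eLpNorm_le hW (hB.add hB.neg)
  have h0 : eLpNorm (fun s => B s + (-B) s) 2 (volume.restrict (Ioc 0 t)) = 0 := by simp
  change _ ≤ eLpNorm (fun s => B s + (-B) s) 2 _ at hle
  rw [h0, nonpos_iff_eq_zero, eLpNorm_eq_zero_iff hs.memLp.1 (by norm_num)] at hle
  filter_upwards [hle] with ω hω
  rw [← sub_eq_zero, sub_eq_add_neg]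
  exact hω

/-- A Wiener integral over `(0, s]` is the Wiener integral over `(0, t]` of the truncation. -/
lemma truncate {s : ℝ} (hst : s ≤ t) (h : IsWienerIntegral P W s B I) :
    IsWienerIntegral P W t ((Ioc 0 s).indicator B) I := by
  obtain ⟨S, h1, h2, h3⟩ := h.approx
  refine ⟨h.memLp, S, fun k i => (h1 k i).trans hst, ?_, h3⟩
  refine h2.congr fun k => ?_
  have : (fun r => (S k).eval r - (Ioc 0 s).indicator B r)
      = (Ioc 0 s).indicator (fun r => (S k).eval r - B r) := by
    ext r
    by_cases hr : r ∈ Ioc 0 s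
    · simp [hr]
    · simp only [indicator_of_notMem hr, sub_zero]
      -- The approximating intervals lie in `(0, s]`, because left endpoints are nonnegative and
      -- right endpoints are at most `s`.
      refine Finset.sum_eq_zero fun i _ => indicator_of_notMem (fun hi => hr ?_) _
      exact ⟨((S k).left i).2.trans_lt hi.1, hi.2.trans (h1 k i)⟩
  rw [this, eLpNorm_indicator_eq_eLpNorm_restrict measurableSet_Ioc,
    Measure.restrict_restrict measurableSet_Ioc, inter_eq_left.2 (Ioc_subset_Ioc_right hst)]

end IsWienerIntegral

/-! ### Wiener integrals as a closed subspace -/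

section WienerGraph

variable {Ω : Type*} [MeasurableSpace Ω] {P : Measure Ω} {W : ℝ≥0 → Ω → ℝ} {t : ℝ}

/-- The pairs of a real step function on `(0, t]` and its elementary integral. -/
def wienerGraph (P : Measure Ω) (W : ℝ≥0 → Ω → ℝ) (t : ℝ) :
    Submodule ℝ (WithLp 2 (Lp ℝ 2 (volume.restrict (Ioc 0 t)) × Lp ℝ 2 P)) where
  carrier := {z | ∃ S : StepFunction ℝ, (∀ i, (S.right i : ℝ) ≤ t) ∧
    z.fst =ᵐ[volume.restrict (Ioc 0 t)] S.eval ∧ z.snd =ᵐ[P] S.integral W}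
  zero_mem' := by
    refine ⟨StepFunction.zero ℝ, fun i => i.elim0, ?_, ?_⟩
    · filter_upwards [Lp.coeFn_zero ℝ 2 (volume.restrict (Ioc 0 t))] with s hs
      rw [WithLp.zero_fst, hs, StepFunction.eval_zero, Pi.zero_apply]
    · filter_upwards [Lp.coeFn_zero ℝ 2 P] with s hs
      rw [WithLp.zero_snd, hs, StepFunction.integral_zero, Pi.zero_apply]
  add_mem' := by
    rintro z z' ⟨S, h1, h2, h3⟩ ⟨S', h1', h2', h3'⟩
    refine ⟨S.add S', StepFunction.right_add_le h1 h1', ?_, ?_⟩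
    · filter_upwards [Lp.coeFn_add z.fst z'.fst, h2, h2'] with s hs hs2 hs2'
      rw [WithLp.add_fst, hs, StepFunction.eval_add, Pi.add_apply, hs2, hs2']
    · filter_upwards [Lp.coeFn_add z.snd z'.snd, h3, h3'] with s hs hs2 hs2'
      rw [WithLp.add_snd, hs, StepFunction.integral_add, Pi.add_apply, hs2, hs2']
  smul_mem' := by
    rintro c z ⟨S, h1, h2, h3⟩
    refine ⟨S.map (c • ContinuousLinearMap.id ℝ ℝ), h1, ?_, ?_⟩
    · filter_upwards [Lp.coeFn_smul c z.fst, h2] with s hs hs2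
      rw [WithLp.smul_fst, hs, StepFunction.eval_map, Pi.smul_apply, hs2]
      rfl
    · filter_upwards [Lp.coeFn_smul c z.snd, h3] with s hs hs2
      rw [WithLp.smul_snd, hs, StepFunction.integral_map, Pi.smul_apply, hs2]
      rfl

lemma IsWienerIntegral.mem_closure_wienerGraph (hW : IsPreBrownianReal W P) {B : ℝ → ℝ}
    {I : Ω → ℝ} (h : IsWienerIntegral P W t B I) (hB : MemLp B 2 (volume.restrict (Ioc 0 t))) :
    WithLp.toLp 2 (hB.toLp B, h.memLp.toLp I) ∈ (wienerGraph P W t).topologicalClosure := by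
  obtain ⟨S, h1, h2, h3⟩ := h.approx
  have l1 := (Lp.tendsto_Lp_iff_tendsto_eLpNorm'' (fun k => (S k).eval)
    (fun k => (S k).memLp_eval t) B hB).2 h2
  have l2 := (Lp.tendsto_Lp_iff_tendsto_eLpNorm'' (fun k => (S k).integral W)
    (fun k => (S k).memLp_integral hW) I h.memLp).2 h3
  have l := ((WithLp.prod_continuous_toLp 2 _ _).tendsto _).comp (l1.prodMk_nhds l2)
  refine mem_closure_of_tendsto l (Eventually.of_forall fun k => ?_)
  exact ⟨S k, h1 k, ((S k).memLp_eval t).coeFn_toLp, ((S k).memLp_integral hW).coeFn_toLp⟩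

lemma isWienerIntegral_of_mem_closure {B : ℝ → ℝ}
    {I : Ω → ℝ} (hB : MemLp B 2 (volume.restrict (Ioc 0 t))) (hI : MemLp I 2 P)
    (h : WithLp.toLp 2 (hB.toLp B, hI.toLp I) ∈ (wienerGraph P W t).topologicalClosure) :
    IsWienerIntegral P W t B I := by
  obtain ⟨z, hz, hlim⟩ := mem_closure_iff_seq_limit.1 h
  choose S h1 h2 h3 using hz
  have l1 := ((WithLp.fstL 2 ℝ _ _).continuous.tendsto _).comp hlim
  have l2 := ((WithLp.sndL 2 ℝ _ _).continuous.tendsto _).comp hlim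
  refine ⟨hI, S, h1, ?_, ?_⟩
  · refine ((Lp.tendsto_Lp_iff_tendsto_eLpNorm _ B hB).1 l1).congr fun k => eLpNorm_congr_ae ?_
    filter_upwards [h2 k] with s hs
    exact congrArg (· - B s) hs
  · refine ((Lp.tendsto_Lp_iff_tendsto_eLpNorm _ I hI).1 l2).congr fun k => eLpNorm_congr_ae ?_
    filter_upwards [h3 k] with s hs
    exact congrArg (· - I s) hs

/-- Wiener integrals are characterized by the linear relations that they satisfy. -/
lemma isWienerIntegral_of_forall_orthogonal (hW : IsPreBrownianReal W P) {B : ℝ → ℝ}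
    {I : Ω → ℝ} (hB : MemLp B 2 (volume.restrict (Ioc 0 t))) (hI : MemLp I 2 P)
    (h : ∀ (a : ℝ → ℝ) (w : Ω → ℝ), MemLp a 2 (volume.restrict (Ioc 0 t)) → MemLp w 2 P →
      (∀ (B' : ℝ → ℝ) (I' : Ω → ℝ), MemLp B' 2 (volume.restrict (Ioc 0 t)) →
        IsWienerIntegral P W t B' I' →
        (∫ s in Ioc 0 t, a s * B' s) + ∫ ω, w ω * I' ω ∂P = 0) →
      (∫ s in Ioc 0 t, a s * B s) + ∫ ω, w ω * I ω ∂P = 0) : IsWienerIntegral P W t B I := by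
  refine isWienerIntegral_of_mem_closure hB hI ?_
  -- The closure is the double orthogonal complement. The same identity below shows that a vector
  -- orthogonal to the step pairs annihilates all Wiener pairs.
  rw [← Submodule.orthogonal_orthogonal_eq_closure, Submodule.mem_orthogonal]
  intro z hz
  have e := h z.fst z.snd (Lp.memLp _) (Lp.memLp _) fun B' I' hB' hI' => by
    have hm := hI'.mem_closure_wienerGraph hW hB'
    rw [← Submodule.orthogonal_orthogonal_eq_closure, Submodule.mem_orthogonal] at hm
    have := hm z hz
    rw [WithLp.prod_inner_apply] at this
    rw [← inner_toLp (Lp.memLp z.fst) hB', ← inner_toLp (Lp.memLp z.snd) hI'.memLp,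
      Lp.toLp_coeFn, Lp.toLp_coeFn]
    exact this
  rw [WithLp.prod_inner_apply]
  rw [← inner_toLp (Lp.memLp z.fst) hB, ← inner_toLp (Lp.memLp z.snd) hI,
    Lp.toLp_coeFn, Lp.toLp_coeFn] at e
  exact e

end WienerGraph

/-! ### Integration by parts for Wiener integrals -/

section IntegrationByParts

variable {Ω : Type*} [MeasurableSpace Ω] {P : Measure Ω} [IsProbabilityMeasure P]
  {W : ℝ≥0 → Ω → ℝ} {t : ℝ} {F : ℝ → ℝ} {M : ℝ → Ω → ℝ}

lemma IsWienerIntegral.integral_sq_le (hW : IsPreBrownianReal W P)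
    (hF : MemLp F 2 (volume.restrict (Ioc 0 t))) {s : ℝ} (hst : s ≤ t) {I : Ω → ℝ}
    (h : IsWienerIntegral P W s F I) : ∫ ω, I ω ^ 2 ∂P ≤ ∫ r in Ioc 0 t, F r ^ 2 := by
  have hle : (volume.restrict (Ioc 0 s) : Measure ℝ) ≤ volume.restrict (Ioc 0 t) :=
    Measure.restrict_mono (Ioc_subset_Ioc_right hst) le_rfl
  exact integral_sq_le_of_eLpNorm_le h.memLp hF
    ((h.eLpNorm_le hW (hF.mono_measure hle).1).trans (eLpNorm_mono_measure F hle))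

/-- A process of Wiener integrals is square integrable in time and space. -/
lemma memLp_uncurry_wiener (hW : IsPreBrownianReal W P)
    (hF : MemLp F 2 (volume.restrict (Ioc 0 t)))
    (hM : AEStronglyMeasurable (fun z : ℝ × Ω => M z.1 z.2) ((volume.restrict (Ioc 0 t)).prod P))
    (h : ∀ s ∈ Ioc 0 t, IsWienerIntegral P W s F (M s)) :
    MemLp (fun z : ℝ × Ω => M z.1 z.2) 2 ((volume.restrict (Ioc 0 t)).prod P) := by
  rw [memLp_two_iff_integrable_sq_norm hM]
  have hm : AEStronglyMeasurable (fun z : ℝ × Ω => ‖M z.1 z.2‖ ^ 2)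
      ((volume.restrict (Ioc 0 t)).prod P) := hM.norm.pow 2
  refine (integrable_prod_iff hm).2 ⟨?_, ?_⟩
  · filter_upwards [ae_restrict_mem measurableSet_Ioc] with s hs
    simpa using (h s hs).memLp.integrable_sq
  -- By the isometry bound the second moments are bounded uniformly in `s`.
  · refine Integrable.of_bound hm.norm.integral_prod_right' (∫ r in Ioc 0 t, F r ^ 2) ?_
    filter_upwards [ae_restrict_mem measurableSet_Ioc] with s hs
    rw [Real.norm_of_nonneg (integral_nonneg fun ω => norm_nonneg _)]
    simpa using (h s hs).integral_sq_le hW hF hs.2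

lemma ae_memLp_wiener (hW : IsPreBrownianReal W P)
    (hF : MemLp F 2 (volume.restrict (Ioc 0 t)))
    (hM : AEStronglyMeasurable (fun z : ℝ × Ω => M z.1 z.2) ((volume.restrict (Ioc 0 t)).prod P))
    (h : ∀ s ∈ Ioc 0 t, IsWienerIntegral P W s F (M s)) :
    ∀ᵐ ω ∂P, MemLp (fun s => M s ω) 2 (volume.restrict (Ioc 0 t)) := by
  have hL := (memLp_two_iff_integrable_sq_norm hM).1 (memLp_uncurry_wiener hW hF hM h)
  filter_upwards [hL.prod_left_ae, hM.prodMk_right] with ω h1 h2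
  exact (memLp_two_iff_integrable_sq_norm h2).2 h1

/-- Integration by parts: `∫₀ᵗ F ψ dW = M(t) ψ(t) - ∫₀ᵗ ψ' M ds` where `M(s) = ∫₀ˢ F dW` and
`ψ` is a primitive of `ψ'`. -/
theorem isWienerIntegral_mul_primitive (hW : IsPreBrownianReal W P) (ht : 0 < t)
    (hF : MemLp F 2 (volume.restrict (Ioc 0 t)))
    (hM : AEStronglyMeasurable (fun z : ℝ × Ω => M z.1 z.2) ((volume.restrict (Ioc 0 t)).prod P))
    (h : ∀ s ∈ Ioc 0 t, IsWienerIntegral P W s F (M s))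
    {ψ' : ℝ → ℝ} (hψ : MemLp ψ' 2 (volume.restrict (Ioc 0 t))) (c : ℝ) :
    IsWienerIntegral P W t (fun s => F s * (c + ∫ r in 0..s, ψ' r))
      (fun ω => M t ω * (c + ∫ r in 0..t, ψ' r) - ∫ s in 0..t, ψ' s * M s ω) := by
  have hψi : IntegrableOn ψ' (Ioc 0 t) := hψ.integrable (by norm_num)
  have hL := memLp_uncurry_wiener hW hF hM h
  have hψ2 : MemLp (fun z : ℝ × Ω => ψ' z.1) 2 ((volume.restrict (Ioc 0 t)).prod P) :=
    hψ.comp_fst P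
  have hψM : Integrable (fun z : ℝ × Ω => ψ' z.1 * M z.1 z.2)
      ((volume.restrict (Ioc 0 t)).prod P) := hψ2.integrable_mul hL
  have htt : t ∈ Ioc 0 t := ⟨ht, le_rfl⟩
  -- Cauchy–Schwarz in time on almost every path, then integration over `Ω`.
  have hcorr : MemLp (fun ω => ∫ s in Ioc 0 t, ψ' s * M s ω) 2 P := by
    have hm : AEStronglyMeasurable (fun ω => ∫ s in Ioc 0 t, ψ' s * M s ω) P :=
      hψM.1.prod_swap.integral_prod_right'
    rw [memLp_two_iff_integrable_sq_norm hm]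
    have hi : Integrable (fun ω => ∫ s in Ioc 0 t, M s ω ^ 2) P := hL.integrable_sq.integral_prod_right
    refine (hi.const_mul (∫ s in Ioc 0 t, ψ' s ^ 2)).mono' (hm.norm.pow 2) ?_
    filter_upwards [ae_memLp_wiener hW hF hM h] with ω hω
    rw [Real.norm_of_nonneg (by positivity), Real.norm_eq_abs, sq_abs]
    exact sq_integral_mul_le hψ hω
  have hI : MemLp (fun ω => M t ω * (c + ∫ r in 0..t, ψ' r) - ∫ s in 0..t, ψ' s * M s ω) 2 P := by
    simp only [intervalIntegral.integral_of_le ht.le (f := fun s => ψ' s * M s _)]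
    exact ((h t htt).memLp.mul_const _).sub hcorr
  obtain ⟨C, hC⟩ := exists_norm_add_primitive_le hψi c
  have hB : MemLp (fun s => F s * (c + ∫ r in 0..s, ψ' r)) 2 (volume.restrict (Ioc 0 t)) := by
    refine MemLp.of_le_mul (c := C) hF (hF.1.mul (aestronglyMeasurable_add_primitive hψi c)) ?_
    filter_upwards [ae_restrict_mem measurableSet_Ioc] with s hs
    rw [norm_mul, mul_comm]
    gcongr
    exact hC s (Ioc_subset_Icc_self hs)
  refine isWienerIntegral_of_forall_orthogonal hW hB hI fun a w ha hw hort => ?_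
  -- Orthogonality is tested on the Wiener integral of `1_{(0, s]} F` over `(0, t]`, which is `M s`.
  have hφ : ∀ s ∈ Ioc 0 t, ∫ ω, w ω * M s ω ∂P = -∫ r in 0..s, a r * F r := by
    intro s hs
    have := hort _ _ (hF.indicator measurableSet_Ioc) ((h s hs).truncate hs.2)
    rw [← eq_neg_iff_add_eq_zero] at this
    rw [intervalIntegral.integral_of_le hs.1.le, eq_neg_iff_add_eq_zero, add_comm,
      ← eq_neg_iff_add_eq_zero, ← this]
    have e : ∀ r, a r * (Ioc 0 s).indicator F r = (Ioc 0 s).indicator (fun r => a r * F r) r :=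
      fun r => by by_cases hr : r ∈ Ioc 0 s <;> simp [hr]
    simp_rw [e]
    rw [setIntegral_indicator measurableSet_Ioc, inter_eq_right.2 (Ioc_subset_Ioc_right hs.2)]
  have haF : IntegrableOn (fun r => a r * F r) (Ioc 0 t) := ha.integrable_mul hF
  have prod := bilin_primitive (ContinuousLinearMap.mul ℝ ℝ) ht.le haF hψi c
  simp only [ContinuousLinearMap.mul_apply'] at prod
  -- Fubini brings the expectation inside, where `hφ` evaluates it; randomness has then disappeared.
  have swap : ∫ ω, w ω * (∫ s in Ioc 0 t, ψ' s * M s ω) ∂P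
      = - ∫ s in Ioc 0 t, (∫ r in 0..s, a r * F r) * ψ' s := by
    have hint : Integrable (fun z : ℝ × Ω => w z.2 * (ψ' z.1 * M z.1 z.2))
        ((volume.restrict (Ioc 0 t)).prod P) := by
      have h2 : MemLp (fun z : ℝ × Ω => ψ' z.1 * w z.2) 2 ((volume.restrict (Ioc 0 t)).prod P) := by
        have hm2 : AEStronglyMeasurable (fun z : ℝ × Ω => ψ' z.1 * w z.2)
            ((volume.restrict (Ioc 0 t)).prod P) := hψ.1.comp_fst.mul hw.1.comp_snd
        rw [memLp_two_iff_integrable_sq_norm hm2]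
        simpa [mul_pow] using hψ.integrable_sq.mul_prod hw.integrable_sq
      refine (h2.integrable_mul hL).congr (Eventually.of_forall fun z => ?_)
      simp only [Pi.mul_apply]
      ring
    simp_rw [← integral_const_mul]
    rw [← integral_integral_swap (f := fun s ω => w ω * (ψ' s * M s ω)) hint, ← integral_neg]
    refine setIntegral_congr_fun measurableSet_Ioc fun s hs => ?_
    have e : ∀ ω, w ω * (ψ' s * M s ω) = ψ' s * (w ω * M s ω) := fun ω => by ring
    simp only [e]
    rw [integral_const_mul, hφ s hs]
    ring
  have e1 : ∀ ω, w ω * (M t ω * (c + ∫ r in 0..t, ψ' r) - ∫ s in 0..t, ψ' s * M s ω)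
      = w ω * M t ω * (c + ∫ r in 0..t, ψ' r) - w ω * ∫ s in Ioc 0 t, ψ' s * M s ω := by
    intro ω
    rw [intervalIntegral.integral_of_le ht.le (f := fun s => ψ' s * M s ω)]
    ring
  simp_rw [e1]
  have i1 : Integrable (fun ω => w ω * M t ω) P := hw.integrable_mul (h t htt).memLp
  have i2 : Integrable (fun ω => w ω * ∫ s in Ioc 0 t, ψ' s * M s ω) P := hw.integrable_mul hcorr
  -- What remains is `prod`, the product rule for the primitives of `a F` and `ψ'`.
  rw [integral_sub (i1.mul_const _) i2, integral_mul_const, hφ t htt, swap, neg_mul, prod,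
    intervalIntegral.integral_of_le ht.le, intervalIntegral.integral_of_le ht.le]
  simp only [← mul_assoc]
  ring

end IntegrationByParts

/-! ### Joint measurability -/

section JointMeasurability

variable {Ω : Type*} [MeasurableSpace Ω] {P : Measure Ω} {E : Type*} [NormedAddCommGroup E]

/-- A process with almost surely continuous paths has a jointly measurable version. -/
lemma aestronglyMeasurable_uncurry_of_continuousOn [SFinite P] {T : ℝ} (hT : 0 ≤ T)
    {Z : ℝ → Ω → E} (hc : ∀ᵐ ω ∂P, ContinuousOn (fun t => Z t ω) (Icc 0 T))
    (hm : ∀ t ∈ Icc 0 T, AEStronglyMeasurable (Z t) P) :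
    AEStronglyMeasurable (fun z : ℝ × Ω => Z z.1 z.2) ((volume.restrict (Icc 0 T)).prod P) := by
  have : Nonempty (Icc (0 : ℝ) T) := ⟨⟨0, le_rfl, hT⟩⟩
  let q : ℕ → Icc (0 : ℝ) T := denseSeq _
  have hq : ∀ n, AEStronglyMeasurable (Z (q n)) P := fun n => hm _ (q n).2
  -- Off one null set the path is continuous and agrees at all times of a countable dense set with
  -- measurable versions. Cutting off there makes every path continuous, and measurability passes
  -- from the dense times to all times by limits.
  have hgood : ∀ᵐ ω ∂P, ContinuousOn (fun t => Z t ω) (Icc 0 T) ∧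
      ∀ n, Z (q n) ω = (hq n).mk _ ω := hc.and (ae_all_iff.2 fun n => (hq n).ae_eq_mk)
  obtain ⟨G, hGm, hG, hGsub⟩ : ∃ G : Set Ω, MeasurableSet G ∧ (∀ᵐ ω ∂P, ω ∈ G) ∧ ∀ ω ∈ G,
      ContinuousOn (fun t => Z t ω) (Icc 0 T) ∧ ∀ n, Z (q n) ω = (hq n).mk _ ω := by
    obtain ⟨N, hN, hNm, hN0⟩ := exists_measurable_superset_of_null (ae_iff.1 hgood)
    refine ⟨Nᶜ, hNm.compl, by simpa [ae_iff] using hN0, fun ω hω => ?_⟩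
    by_contra hn
    exact hω (hN hn)
  let u : Icc (0 : ℝ) T → Ω → E := fun i => G.indicator (Z i)
  have hu_cont : ∀ ω, Continuous fun i => u i ω := by
    intro ω
    by_cases hω : ω ∈ G
    · simp only [u, indicator_of_mem hω]
      exact continuousOn_iff_continuous_domRestrict.1 (hGsub ω hω).1
    · simpa only [u, indicator_of_notMem hω] using continuous_const
  have hu_q : ∀ n, StronglyMeasurable (u (q n)) := by
    intro n
    have : u (q n) = G.indicator ((hq n).mk _) := by
      ext ω
      by_cases hω : ω ∈ G
      · simp [u, hω, (hGsub ω hω).2 n]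
      · simp [u, hω]
    rw [this]
    exact (hq n).stronglyMeasurable_mk.indicator hGm
  have hu : ∀ i, StronglyMeasurable (u i) := by
    intro i
    obtain ⟨x, hx, hlim⟩ := mem_closure_iff_seq_limit.1 ((denseRange_denseSeq _) i)
    refine stronglyMeasurable_of_tendsto (f := fun n => u (x n)) atTop (fun n => ?_) ?_
    · obtain ⟨k, hk⟩ := hx n
      simpa only [← hk] using hu_q k
    · exact tendsto_pi_nhds.2 fun ω => ((hu_cont ω).tendsto i).comp hlim
  have hU := stronglyMeasurable_uncurry_of_continuous_of_stronglyMeasurable hu_cont hu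
  have hproj : Measurable fun z : ℝ × Ω => (projIcc 0 T hT z.1, z.2) :=
    (continuous_projIcc.measurable.comp measurable_fst).prodMk measurable_snd
  refine (hU.comp_measurable hproj).aestronglyMeasurable.congr ?_
  have h1 : ∀ᵐ z ∂((volume.restrict (Icc 0 T)).prod P), z.1 ∈ Icc 0 T :=
    Measure.quasiMeasurePreserving_fst.ae (ae_restrict_mem measurableSet_Icc)
  have h2 : ∀ᵐ z ∂((volume.restrict (Icc 0 T)).prod P), z.2 ∈ G :=
    Measure.quasiMeasurePreserving_snd.ae hG
  filter_upwards [h1, h2] with z hz1 hz2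
  simp only [Function.comp_apply, Function.uncurry, u, indicator_of_mem hz2,
    projIcc_of_mem hT hz1]

/-- Tonelli for the norm. It converts an identity valid almost surely at each time into one valid at
almost every time on almost every path. -/
lemma ae_ae_eq_zero_swap [SFinite P] {μ : Measure ℝ} [SFinite μ] {h : ℝ → Ω → E}
    (hm : AEStronglyMeasurable (fun z : ℝ × Ω => h z.1 z.2) (μ.prod P))
    (h0 : ∀ᵐ t ∂μ, ∀ᵐ ω ∂P, h t ω = 0) : ∀ᵐ ω ∂P, ∀ᵐ t ∂μ, h t ω = 0 := by
  have hz : ∀ᵐ z ∂(μ.prod P), h z.1 z.2 = 0 := by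
    have : ∫⁻ z, ‖h z.1 z.2‖ₑ ∂(μ.prod P) = 0 := by
      rw [lintegral_prod _ hm.enorm]
      refine lintegral_eq_zero_of_ae_eq_zero ?_
      filter_upwards [h0] with t ht
      refine lintegral_eq_zero_of_ae_eq_zero ?_
      filter_upwards [ht] with ω hω
      simp [hω]
    filter_upwards [(lintegral_eq_zero_iff' hm.enorm).1 this] with z hz
    simpa using hz
  exact Measure.ae_ae_of_ae_prod
    ((Measure.measurePreserving_swap (μ := P) (ν := μ)).quasiMeasurePreserving.ae hz)

end JointMeasurability

/-! ### The noise of a strong solution -/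

section StrongSolution

variable {Ω : Type*} [MeasurableSpace Ω] {P : Measure Ω} [IsProbabilityMeasure P]
  {W : ℝ≥0 → Ω → ℝ} {E : Type*} [NormedAddCommGroup E] [InnerProductSpace ℝ E] [CompleteSpace E]
  {T : ℝ} {A : E →ₗ.[ℝ] E} {f : ℝ → ℝ} {b : E} {X : ℝ → Ω → E}

/-- The noise of a strong solution with the multiplicative forcing `f(t) b` is `M(t) b` with a
jointly measurable process `M` of real Wiener integrals. -/
theorem IsStrongSolution.exists_wiener (hW : IsPreBrownianReal W P) (hT : 0 ≤ T)
    (hf : MemLp f 2 (volume.restrict (Icc 0 T)))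
    (h : IsStrongSolution P W T A (fun s => f s • b) X) :
    ∃ (F : ℝ → ℝ) (M : ℝ → Ω → ℝ), (∀ s, F s • b = f s • b) ∧
      MemLp F 2 (volume.restrict (Icc 0 T)) ∧
      AEStronglyMeasurable (fun z : ℝ × Ω => M z.1 z.2) ((volume.restrict (Icc 0 T)).prod P) ∧
      (∀ t ∈ Icc 0 T, IsWienerIntegral P W t F (M t)) ∧
      (∀ t ∈ Icc 0 T, ∀ᵐ ω ∂P,
        X t ω = -(∫ s in 0..t, applyOrZero A (X s ω)) + M t ω • b) ∧
      ∀ᵐ ω ∂P, ∀ᵐ t ∂(volume.restrict (Icc 0 T)),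
        X t ω = -(∫ s in 0..t, applyOrZero A (X s ω)) + M t ω • b := by
  set Z : ℝ → Ω → E := fun t ω => ∫ s in 0..t, applyOrZero A (X s ω) with hZ
  have hft : ∀ t ∈ Icc 0 T, MemLp f 2 (volume.restrict (Ioc 0 t)) := fun t ht =>
    hf.mono_measure (Measure.restrict_mono (Ioc_subset_Icc_self.trans
      (Icc_subset_Icc_right ht.2)) le_rfl)
  -- The integrals `I` are chosen separately for each `t`; `X + ∫ A X` is a version of them that can
  -- be studied as a process.
  have hN : ∀ t ∈ Icc 0 T, IsWienerIntegral P W t (fun s => f s • b) (fun ω => X t ω + Z t ω) := by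
    intro t ht
    obtain ⟨I, hI, hX⟩ := h.eq t ht
    refine hI.congr Filter.EventuallyEq.rfl ?_
    filter_upwards [hX] with ω hω
    rw [hω]
    simp [hZ]
  have hZc : ∀ᵐ ω ∂P, ContinuousOn (fun t => Z t ω) (Icc 0 T) := by
    filter_upwards [h.integrable] with ω hω
    have := continuousOn_add_primitive (hω.mono_set Ioc_subset_Icc_self) 0
    simpa only [zero_add] using this
  -- `Z t` is a pathwise integral; its measurability in `ω` is read off as the Wiener integral minus
  -- `X t`.
  have hZm : ∀ t ∈ Icc 0 T, AEStronglyMeasurable (Z t) P := by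
    intro t ht
    have := (hN t ht).memLp.1.sub (h.measurable t ht)
    refine this.congr (Eventually.of_forall fun ω => ?_)
    simp
  have hZj := aestronglyMeasurable_uncurry_of_continuousOn hT hZc hZm
  have hNj := h.measurable_uncurry.add hZj
  -- The coordinate along `b`. If `b = 0`, then `L = 0` and `F` vanishes, so in general only `F b =
  -- f b` holds, not `F = f`.
  let L : E →L[ℝ] ℝ := (‖b‖ ^ 2)⁻¹ • (innerSL ℝ b : E →L[ℝ] ℝ)
  have hLb : L b • b = b := by
    by_cases hb : b = 0
    · simp [hb]
    · have : L b = 1 := by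
        have hn : ‖b‖ ≠ 0 := norm_ne_zero_iff.2 hb
        change (‖b‖ ^ 2)⁻¹ * inner ℝ b b = 1
        rw [real_inner_self_eq_norm_sq]
        field_simp
      rw [this, one_smul]
  have hF : ∀ t ∈ Icc 0 T, IsWienerIntegral P W t (fun s => f s * L b)
      (fun ω => L (X t ω + Z t ω)) := by
    intro t ht
    simpa only [map_smul, smul_eq_mul] using (hN t ht).map L
  have hFb : ∀ s, (f s * L b) • b = f s • b := fun s => by rw [mul_smul, hLb]
  -- Projecting onto `b` does not change the integrand `f b`, so by uniqueness it does not change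
  -- the integral.
  have hMt : ∀ t ∈ Icc 0 T, ∀ᵐ ω ∂P, X t ω + Z t ω = L (X t ω + Z t ω) • b := by
    intro t ht
    have h1 := (hF t ht).map (ContinuousLinearMap.toSpanSingleton ℝ b)
    simp only [ContinuousLinearMap.toSpanSingleton_apply, hFb] at h1
    exact (hN t ht).unique hW (memLp_smul_const (hft t ht) b).1 h1
  have hMj : AEStronglyMeasurable (fun z : ℝ × Ω => L (X z.1 z.2 + Z z.1 z.2))
      ((volume.restrict (Icc 0 T)).prod P) := L.continuous.comp_aestronglyMeasurable hNj
  refine ⟨fun s => f s * L b, fun t ω => L (X t ω + Z t ω), hFb, hf.mul_const _, hMj, hF, ?_, ?_⟩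
  · intro t ht
    filter_upwards [hMt t ht] with ω hω
    rw [← hω]
    abel
  · have hd : AEStronglyMeasurable (fun z : ℝ × Ω => X z.1 z.2 + Z z.1 z.2
        - L (X z.1 z.2 + Z z.1 z.2) • b) ((volume.restrict (Icc 0 T)).prod P) :=
      hNj.sub (hMj.smul_const b)
    have := ae_ae_eq_zero_swap (h := fun t ω => X t ω + Z t ω - L (X t ω + Z t ω) • b) hd (by
      filter_upwards [ae_restrict_mem measurableSet_Icc] with t ht
      filter_upwards [hMt t ht] with ω hω
      exact sub_eq_zero.2 hω)
    filter_upwards [this] with ω hω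
    filter_upwards [hω] with t ht
    rw [← sub_eq_zero.1 ht]
    abel

end StrongSolution

/-! ### Weak derivatives in a dual space through Riesz representatives -/

section Riesz

variable {V : Type*} [NormedAddCommGroup V] [InnerProductSpace ℝ V] [CompleteSpace V]

/-- The Riesz isomorphism `V* → V` of a real Hilbert space as a continuous linear map. -/
def riesz (V : Type*) [NormedAddCommGroup V] [InnerProductSpace ℝ V] [CompleteSpace V] :
    StrongDual ℝ V →L[ℝ] V :=
  ((InnerProductSpace.toDual ℝ V).symm.toContinuousLinearEquiv : StrongDual ℝ V →L⋆[ℝ] V)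

lemma inner_riesz (l : StrongDual ℝ V) (w : V) : inner ℝ (riesz V l) w = l w :=
  InnerProductSpace.toDual_symm_apply

lemma inner_sub_smul_left (v g w : V) (m : ℝ) :
    inner ℝ (v - m • g) w = inner ℝ v w - inner ℝ w g * m := by
  rw [inner_sub_left, real_inner_smul_left, real_inner_comm g, mul_comm]

lemma inner_add_primitive {θ : ℝ → V} {s : ℝ} (c w : V) (hs : 0 ≤ s)
    (hθ : IntegrableOn θ (Ioc 0 s)) :
    inner ℝ (c + ∫ r in 0..s, θ r) w = inner ℝ c w + ∫ r in 0..s, inner ℝ (θ r) w := by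
  rw [inner_add_left, intervalIntegral.integral_of_le hs, intervalIntegral.integral_of_le hs]
  congr 1
  exact (((innerBilin V).flip w).integral_comp_comm hθ).symm

lemma inner_add_primitive_right {θ : ℝ → V} {s : ℝ} (w c : V) (hs : 0 ≤ s)
    (hθ : IntegrableOn θ (Ioc 0 s)) :
    inner ℝ w (c + ∫ r in 0..s, θ r) = inner ℝ w c + ∫ r in 0..s, inner ℝ w (θ r) := by
  rw [inner_add_right, intervalIntegral.integral_of_le hs, intervalIntegral.integral_of_le hs]
  congr 1
  exact ((innerBilin V w).integral_comp_comm hθ).symm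

lemma clm_add_primitive {U : Type*} [NormedAddCommGroup U] [NormedSpace ℝ U] [CompleteSpace U]
    (L : U →L[ℝ] V) {θ : ℝ → U} {s : ℝ} (c : U) (hs : 0 ≤ s) (hθ : IntegrableOn θ (Ioc 0 s)) :
    L (c + ∫ r in 0..s, θ r) = L c + ∫ r in 0..s, L (θ r) := by
  rw [map_add, intervalIntegral.integral_of_le hs, intervalIntegral.integral_of_le hs,
    L.integral_comp_comm hθ]

lemma riesz_innerBilin (v : V) : riesz V (innerBilin V v) = v := by
  refine ext_inner_right ℝ fun w => ?_
  rw [inner_riesz, innerBilin_apply]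

/-- The Riesz representative of a function with values in a dual space that has a weak
derivative. -/
lemma exists_riesz_primitive {T : ℝ} (hT : 0 < T) {y : ℝ → V} {y' : ℝ → StrongDual ℝ V}
    (hy : MemLp y 2 (volume.restrict (Icc 0 T))) (hy' : MemLp y' 2 (volume.restrict (Icc 0 T)))
    (h : HasWeakTimeDeriv T (fun s => innerBilin V (y s)) y') :
    ∃ c : V, ∀ᵐ s ∂(volume.restrict (Icc 0 T)), y s = c + ∫ r in 0..s, riesz V (y' r) := by
  have hyi : IntegrableOn (fun s => innerBilin V (y s)) (Icc 0 T) :=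
    ((innerBilin V).comp_memLp' hy).integrable (by norm_num)
  have hyi' : IntegrableOn y' (Icc 0 T) := hy'.integrable (by norm_num)
  obtain ⟨c, hc⟩ := h.exists_eq_primitive hT hyi hyi'
  refine ⟨riesz V c, ?_⟩
  filter_upwards [hc, ae_restrict_mem measurableSet_Icc] with s hs hsm
  rw [← riesz_innerBilin (y s), hs, clm_add_primitive _ _ hsm.1]
  exact hyi'.mono_set (Ioc_subset_Icc_self.trans (Icc_subset_Icc_right hsm.2))

/-- The case of a function with values in a space `H` that is embedded in the dual space by
`v ↦ ⟨v, J ·⟩`. -/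
lemma exists_riesz_primitive_of_embedding {H : Type*} [NormedAddCommGroup H]
    [InnerProductSpace ℝ H] [CompleteSpace H] (J : V →L[ℝ] H) {T : ℝ} (hT : 0 < T) {z : ℝ → H}
    {y' : ℝ → StrongDual ℝ V} (hz : MemLp z 2 (volume.restrict (Icc 0 T)))
    (hy' : MemLp y' 2 (volume.restrict (Icc 0 T)))
    (h : HasWeakTimeDeriv T (fun s => (innerSL ℝ (z s)).comp J) y') :
    ∃ (c : V) (θ : ℝ → V), MemLp θ 2 (volume.restrict (Icc 0 T)) ∧
      (∀ s w, y' s w = inner ℝ (θ s) w) ∧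
      ∀ᵐ s ∂(volume.restrict (Icc 0 T)), adjoint J (z s) = c + ∫ r in 0..s, θ r := by
  -- The Riesz representative of `⟨z, J ·⟩` is `J† z`.
  have e : (fun s => (innerSL ℝ (z s)).comp J) = fun s => innerBilin V (adjoint J (z s)) := by
    ext s w
    rw [innerBilin_apply, adjoint_inner_left]
    rfl
  rw [e] at h
  obtain ⟨c, hc⟩ := exists_riesz_primitive hT ((adjoint J).comp_memLp' hz) hy' h
  exact ⟨c, _, (riesz V).comp_memLp' hy', fun s w => (inner_riesz _ _).symm, hc⟩

lemma integrable_inner_of_memLp {α : Type*} [MeasurableSpace α] {μ : Measure α} {x y : α → V}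
    (hx : MemLp x 2 μ) (hy : MemLp y 2 μ) : Integrable (fun s => inner ℝ (x s) (y s)) μ :=
  (hx.norm.integrable_mul hy.norm).mono' (hx.1.inner hy.1)
    (Eventually.of_forall fun _ => norm_inner_le_norm _ _)

end Riesz

/-! ### Paths of the heat equation -/

section Sobolev

variable {d : ℕ} {D : Opens (Euc d)}

lemma norm_sq_H10 (v : H10 D) : ‖v‖ ^ 2 = ‖toL2 D v‖ ^ 2 + ‖grad D v‖ ^ 2 :=
  WithLp.prod_norm_sq_eq_of_L2 (v : WithLp 2 (L2 D × L2Vec D))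

/-- Lusin–Souslin: a continuous injection between separable complete metric spaces is a measurable
embedding, so measurability in `L²(D)` lifts to `H¹₀(D)`. -/
lemma aestronglyMeasurable_liftH10 {μ : Measure ℝ} {u : ℝ → L2 D} (hu : AEStronglyMeasurable u μ)
    (hr : ∀ᵐ s ∂μ, ∃ v, toL2 D v = u s) : AEStronglyMeasurable (fun s => liftH10 D (u s)) μ := by
  have h2 : Fact ((2 : ℝ≥0∞) ≠ ∞) := ⟨by norm_num⟩
  have : SecondCountableTopology (L2 D) := inferInstance
  have : SecondCountableTopology (L2Vec D) := inferInstance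
  have : SecondCountableTopology (WithLp 2 (L2 D × L2Vec D)) := inferInstance
  have : SecondCountableTopology (H10 D) := inferInstance
  borelize (L2 D) (H10 D)
  have he := (toL2 D).continuous.measurableEmbedding (toL2_injective D)
  refine AEMeasurable.aestronglyMeasurable (he.aemeasurable_comp_iff.1 ?_)
  refine hu.aemeasurable.congr ?_
  filter_upwards [hr] with s hs
  obtain ⟨v, hv⟩ := hs
  simp only [Function.comp_apply, ← hv, liftH10_toL2]

lemma exists_of_mem_domain_dirichletLaplacian {x : L2 D}
    (hx : x ∈ (dirichletLaplacian D).domain) :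
    ∃ v : H10 D, toL2 D v = x ∧ ∀ φ : H10 D, inner ℝ (grad D v) (grad D φ)
      = - inner ℝ (applyOrZero (dirichletLaplacian D) x) (toL2 D φ) := by
  have hm : (x, dirichletLaplacian D ⟨x, hx⟩) ∈ dirichletGraph D := by
    rw [← dirichletLaplacian_graph]
    exact (dirichletLaplacian D).mem_graph ⟨x, hx⟩
  rw [applyOrZero, dif_pos hx]
  exact hm

lemma applyOrZero_neg {E : Type*} [AddCommGroup E] [Module ℝ E] (A : E →ₗ.[ℝ] E) (x : E) :
    applyOrZero (-A) x = - applyOrZero A x := by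
  by_cases h : x ∈ A.domain
  · rw [applyOrZero, applyOrZero, dif_pos h, dif_pos (show x ∈ (-A).domain from h)]
    rfl
  · rw [applyOrZero, applyOrZero, dif_neg h, dif_neg (show x ∉ (-A).domain from h), neg_zero]

variable {t : ℝ} {v : ℝ → H10 D} {h : ℝ → L2 D} {m : ℝ → ℝ} {g : H10 D}

/-- The energy estimate for the heat equation. -/
lemma memLp_of_heat (hv : AEStronglyMeasurable v (volume.restrict (Ioc 0 t)))
    (hh : IntegrableOn h (Ioc 0 t)) (hm : MemLp m 2 (volume.restrict (Ioc 0 t)))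
    (hvm : ∀ᵐ s ∂(volume.restrict (Ioc 0 t)),
      toL2 D (v s) = (∫ r in 0..s, h r) + m s • toL2 D g)
    (hvh : ∀ᵐ s ∂(volume.restrict (Ioc 0 t)), ∀ φ : H10 D,
      inner ℝ (grad D (v s)) (grad D φ) = - inner ℝ (h s) (toL2 D φ)) :
    MemLp v 2 (volume.restrict (Ioc 0 t)) := by
  rw [memLp_two_iff_integrable_sq_norm hv]
  obtain ⟨C, hC⟩ := exists_norm_add_primitive_le hh 0
  simp only [zero_add] at hC
  have hb : Integrable (fun s => 2 * C ^ 2 + 2 * ‖toL2 D g‖ ^ 2 * m s ^ 2 + 2 * C * ‖h s‖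
      + ‖grad D g‖ ^ 2 * m s ^ 2) (volume.restrict (Ioc 0 t)) :=
    (((integrable_const _).add (hm.integrable_sq.const_mul _)).add (hh.norm.const_mul _)).add
      (hm.integrable_sq.const_mul _)
  refine hb.mono' (hv.norm.pow 2) ?_
  filter_upwards [hvm, hvh, ae_restrict_mem measurableSet_Ioc] with s h1 h2 hs
  rw [Real.norm_of_nonneg (by positivity), norm_sq_H10]
  have hY := hC s (Ioc_subset_Icc_self hs)
  set Y := ∫ r in 0..s, h r
  have e1 : ‖toL2 D (v s)‖ ^ 2 ≤ 2 * C ^ 2 + 2 * ‖toL2 D g‖ ^ 2 * m s ^ 2 := by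
    have : ‖toL2 D (v s)‖ ≤ C + |m s| * ‖toL2 D g‖ := by
      rw [h1]
      refine (norm_add_le _ _).trans ?_
      rw [norm_smul, Real.norm_eq_abs]
      gcongr
    calc ‖toL2 D (v s)‖ ^ 2 ≤ (C + |m s| * ‖toL2 D g‖) ^ 2 := by gcongr
      _ ≤ 2 * C ^ 2 + 2 * (|m s| * ‖toL2 D g‖) ^ 2 := by
        nlinarith [sq_nonneg (C - |m s| * ‖toL2 D g‖)]
      _ = _ := by rw [mul_pow, sq_abs]; ring
  -- Testing with `v = Y + m g` gives `‖∇v‖² = -⟨h, Y⟩ + m ⟨∇v, ∇g⟩`. As `Y` is bounded by `C`, the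
  -- first term costs only the integrable `‖h‖`; Young's inequality absorbs `‖∇v‖` in the second.
  have e2 : ‖grad D (v s)‖ ^ 2 ≤ 2 * C * ‖h s‖ + ‖grad D g‖ ^ 2 * m s ^ 2 := by
    have a1 := h2 (v s)
    have a2 := h2 g
    rw [real_inner_self_eq_norm_sq, h1, inner_add_right, real_inner_smul_right] at a1
    have a3 : -inner ℝ (h s) Y ≤ ‖h s‖ * C := by
      have := neg_le_of_abs_le (abs_real_inner_le_norm (h s) Y)
      nlinarith [mul_le_mul_of_nonneg_left hY (norm_nonneg (h s))]
    have a4 : m s * inner ℝ (grad D (v s)) (grad D g)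
        ≤ ‖grad D (v s)‖ * (|m s| * ‖grad D g‖) := by
      calc m s * inner ℝ (grad D (v s)) (grad D g)
          ≤ |m s| * |inner ℝ (grad D (v s)) (grad D g)| := by
            rw [← abs_mul]; exact le_abs_self _
        _ ≤ |m s| * (‖grad D (v s)‖ * ‖grad D g‖) := by
            gcongr; exact abs_real_inner_le_norm _ _
        _ = _ := by ring
    have a5 : ‖grad D (v s)‖ ^ 2 ≤ ‖h s‖ * C + ‖grad D (v s)‖ * (|m s| * ‖grad D g‖) := by
      have : m s * inner ℝ (h s) (toL2 D g) = - (m s * inner ℝ (grad D (v s)) (grad D g)) := by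
        rw [a2]; ring
      linarith
    have a6 : (|m s| * ‖grad D g‖) ^ 2 = ‖grad D g‖ ^ 2 * m s ^ 2 := by
      rw [mul_pow, sq_abs]; ring
    rw [← a6]
    nlinarith [sq_nonneg (‖grad D (v s)‖ - |m s| * ‖grad D g‖)]
  linarith

/-- The duality formula along a path of the heat equation without its noise. -/
lemma inner_heat_path (ht : 0 ≤ t) (hv : MemLp v 2 (volume.restrict (Ioc 0 t)))
    (hh : IntegrableOn h (Ioc 0 t)) (hm : MemLp m 2 (volume.restrict (Ioc 0 t)))
    (hvm : ∀ᵐ s ∂(volume.restrict (Ioc 0 t)),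
      toL2 D (v s) = (∫ r in 0..s, h r) + m s • toL2 D g)
    (hvh : ∀ᵐ s ∂(volume.restrict (Ioc 0 t)), ∀ φ : H10 D,
      inner ℝ (grad D (v s)) (grad D φ) = - inner ℝ (h s) (toL2 D φ))
    {ζ θ : ℝ → H10 D} {c : H10 D} (hζ : MemLp ζ 2 (volume.restrict (Ioc 0 t)))
    (hθ : MemLp θ 2 (volume.restrict (Ioc 0 t)))
    (hζθ : ∀ᵐ s ∂(volume.restrict (Ioc 0 t)),
      adjoint (toL2 D) (toL2 D (ζ s)) = c + ∫ r in 0..s, θ r)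
    (hζt : adjoint (toL2 D) (toL2 D (ζ t)) = c + ∫ r in 0..t, θ r) :
    IntegrableOn (fun s => inner ℝ (h s) (toL2 D (ζ s))) (Ioc 0 t) ∧
    inner ℝ (∫ s in 0..t, h s) (toL2 D (ζ t)) = (∫ s in 0..t, inner ℝ (h s) (toL2 D (ζ s)))
      + ∫ s in 0..t, inner ℝ (v s - m s • g) (θ s) := by
  -- In `H⁻¹` the Laplacian is bounded by the gradient: `J† h = -∇†∇ v`. This turns integrability in
  -- time of `h` into square integrability.
  have hη : MemLp (fun s => adjoint (toL2 D) (h s)) 2 (volume.restrict (Ioc 0 t)) := by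
    have := ((adjoint (grad D) ∘L grad D).comp_memLp' hv).neg
    refine (memLp_congr_ae ?_).1 this
    filter_upwards [hvh] with s hs
    refine ext_inner_right ℝ fun w => ?_
    rw [adjoint_inner_left, Pi.neg_apply, inner_neg_left, Function.comp_apply,
      ContinuousLinearMap.comp_apply, adjoint_inner_left, hs, neg_neg]
  have hprim : ∀ s ∈ Icc 0 t, adjoint (toL2 D) (∫ r in 0..s, h r)
      = ∫ r in 0..s, adjoint (toL2 D) (h r) := by
    intro s hs
    have := clm_add_primitive (adjoint (toL2 D)) 0 hs.1 (hh.mono_set (Ioc_subset_Ioc_right hs.2))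
    simpa using this
  have hy : MemLp (fun s => v s - m s • g) 2 (volume.restrict (Ioc 0 t)) :=
    hv.sub (memLp_smul_const hm g)
  -- Removing the noise `m g`, which lies in `H¹₀`, leaves a function whose image under `J†J` is a
  -- primitive.
  have key := inner_primitive_of_gelfand (toL2_injective D) ht hy hη hζ hθ (by
    filter_upwards [hvm, ae_restrict_mem measurableSet_Ioc] with s hs hsm
    rw [map_sub, hs, map_smul, add_sub_cancel_right, hprim s (Ioc_subset_Icc_self hsm)]) hζθ hζt
  rw [← hprim t ⟨ht, le_rfl⟩] at key
  simp only [adjoint_inner_left] at key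
  refine ⟨?_, key⟩
  have := integrable_inner_of_memLp hη hζ
  simp only [adjoint_inner_left] at this
  exact this

end Sobolev

/-! ### The heat equation -/

section Heat

variable {d : ℕ} {D : Opens (Euc d)} {T : ℝ} {Ω : Type*} [MeasurableSpace Ω] {P : Measure Ω}
  [IsProbabilityMeasure P] {W : ℝ≥0 → Ω → ℝ} {f : ℝ → ℝ} {g : H10 D}

lemma restrict_Ioc_le {t : ℝ} (ht : t ≤ T) :
    (volume.restrict (Ioc 0 t) : Measure ℝ) ≤ volume.restrict (Icc 0 T) :=
  Measure.restrict_mono (Ioc_subset_Icc_self.trans (Icc_subset_Icc_right ht)) le_rfl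

set_option maxHeartbeats 1000000 in
/-- The duality formula for strong solutions of the stochastic heat equation. -/
theorem IsStrongSolutionHeat.duality (hW : IsPreBrownianReal W P) (hT : 0 < T)
    (hf : MemLp f 2 (volume.restrict (Icc 0 T))) {u : ℝ → Ω → L2 D}
    (hu : IsStrongSolutionHeat D P W T f (toL2 D g) u)
    {ζ : ℝ → H10 D} {dζ : ℝ → HNeg1 D} (hζ : MemLp ζ 2 (volume.restrict (Icc 0 T)))
    (hdζ : MemLp dζ 2 (volume.restrict (Icc 0 T)))
    (hw : HasWeakTimeDeriv T (fun s => toHNeg1 D (toL2 D (ζ s))) dζ) :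
    ∀ᵐ t ∂(volume.restrict (Icc 0 T)), ∃ I : Ω → ℝ,
      IsWienerIntegral P W t (fun s => f s * inner ℝ (toL2 D g) (toL2 D (ζ s))) I ∧
      ∀ᵐ ω ∂P,
        IntervalIntegrable (fun s =>
          inner ℝ (applyOrZero (dirichletLaplacian D) (u s ω)) (toL2 D (ζ s))) volume 0 t ∧
        IntervalIntegrable (fun s => dζ s (liftH10 D (u s ω))) volume 0 t ∧
        inner ℝ (u t ω) (toL2 D (ζ t))
          = (∫ s in 0..t,
              inner ℝ (applyOrZero (dirichletLaplacian D) (u s ω)) (toL2 D (ζ s)))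
            + (∫ s in 0..t, dζ s (liftH10 D (u s ω)))
            + I ω := by
  obtain ⟨F, M, hFb, hF, hMj, hMW, hMt, hMae⟩ :=
    IsStrongSolution.exists_wiener hW hT.le hf (hu : IsStrongSolution P W T _ _ u)
  simp only [applyOrZero_neg, intervalIntegral.integral_neg, neg_neg] at hMt hMae
  obtain ⟨c, θ, hθ, hdθ, hc⟩ := exists_riesz_primitive_of_embedding (V := H10 D) (H := L2 D)
    (toL2 D) hT ((toL2 D).comp_memLp' hζ) hdζ hw
  have hpos : ∀ᵐ t ∂(volume.restrict (Icc 0 T)), t ∈ Ioc 0 T := by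
    rw [← Measure.restrict_congr_set Ioc_ae_eq_Icc]
    exact ae_restrict_mem measurableSet_Ioc
  -- These are the times at which `ζ t` agrees with its continuous representative in `H⁻¹`.
  filter_upwards [hc, hpos] with t hct ht
  have hle := restrict_Ioc_le ht.2
  have htI : t ∈ Icc 0 T := Ioc_subset_Icc_self ht
  have hθt := hθ.mono_measure hle
  have hθi : IntegrableOn θ (Ioc 0 t) := hθt.integrable (by norm_num)
  have hψ : MemLp (fun s => inner ℝ (θ s) g) 2 (volume.restrict (Ioc 0 t)) :=
    ((innerBilin (H10 D)).flip g).comp_memLp' hθt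
  have hMjt : AEStronglyMeasurable (fun z : ℝ × Ω => M z.1 z.2)
      ((volume.restrict (Ioc 0 t)).prod P) := hMj.mono_measure (Measure.prod_mono hle le_rfl)
  have hMWt : ∀ s ∈ Ioc 0 t, IsWienerIntegral P W s F (M s) := fun s hs =>
    hMW s ⟨hs.1.le, hs.2.trans ht.2⟩
  have hFt := hF.mono_measure hle
  have hI := isWienerIntegral_mul_primitive hW ht.1 hFt hMjt hMWt hψ (inner ℝ c g)
  -- Since `g ∈ H¹₀`, the scalar `⟨g, ζ⟩ = ⟨J†J ζ, g⟩` is a primitive of `⟨θ, g⟩`, although `ζ` is a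
  -- primitive only in `H⁻¹`.
  have hψe : ∀ s ∈ Ioc 0 t, adjoint (toL2 D) (toL2 D (ζ s)) = c + ∫ r in 0..s, θ r →
      inner ℝ c g + ∫ r in 0..s, inner ℝ (θ r) g = inner ℝ (toL2 D g) (toL2 D (ζ s)) := by
    intro s hs hcs
    rw [← inner_add_primitive c g hs.1.le (hθi.mono_set (Ioc_subset_Ioc_right hs.2)), ← hcs,
      adjoint_inner_left, real_inner_comm]
  refine ⟨_, hI.congr ?_ Filter.EventuallyEq.rfl, ?_⟩
  · filter_upwards [ae_mono hle hc, ae_restrict_mem measurableSet_Ioc] with s hs hsm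
    rw [hψe s hsm hs, ← real_inner_smul_left, ← real_inner_smul_left, hFb]
  filter_upwards [hMt t htI, hMae, hu.mem_domain, hu.integrable, hu.measurable_uncurry.prodMk_right,
    ae_memLp_wiener hW hFt hMjt hMWt] with ω h1 h2 h3 h4 h5 hm
  simp only [applyOrZero_neg] at h4
  set h : ℝ → L2 D := fun s => applyOrZero (dirichletLaplacian D) (u s ω) with hdef
  set v : ℝ → H10 D := fun s => liftH10 D (u s ω) with hvdef
  have hh : IntegrableOn h (Ioc 0 t) := by
    have : IntegrableOn h (Icc 0 T) := by simpa [hdef] using h4.neg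
    exact Integrable.mono_measure this hle
  have hdom : ∀ᵐ s ∂(volume.restrict (Icc 0 T)), toL2 D (v s) = u s ω ∧ ∀ φ : H10 D,
      inner ℝ (grad D (v s)) (grad D φ) = - inner ℝ (h s) (toL2 D φ) := by
    filter_upwards [h3] with s hs
    obtain ⟨w, hw, hφ⟩ := exists_of_mem_domain_dirichletLaplacian hs
    have : v s = w := by rw [hvdef]; simp only [← hw, liftH10_toL2]
    rw [this]
    exact ⟨hw, hφ⟩
  have hv : AEStronglyMeasurable v (volume.restrict (Ioc 0 t)) :=
    (aestronglyMeasurable_liftH10 h5 (hdom.mono fun s hs => ⟨_, hs.1⟩)).mono_measure hle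
  have hvm : ∀ᵐ s ∂(volume.restrict (Ioc 0 t)),
      toL2 D (v s) = (∫ r in 0..s, h r) + M s ω • toL2 D g := by
    filter_upwards [ae_mono hle h2, ae_mono hle hdom] with s hs hs'
    rw [hs'.1, hs]
  have hvh := ae_mono hle (hdom.mono fun s hs => hs.2)
  have hv2 := memLp_of_heat hv hh hm hvm hvh
  obtain ⟨i1, e1⟩ := inner_heat_path ht.1.le hv2 hh hm hvm hvh (hζ.mono_measure hle) hθt
    (ae_mono hle hc) hct
  have hdv : ∀ s, dζ s (liftH10 D (u s ω)) = inner ℝ (v s) (θ s) := fun s => by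
    rw [real_inner_comm, hdθ]
  have i2 := integrable_inner_of_memLp hv2 hθt
  have i3 : Integrable (fun s => inner ℝ (θ s) g * M s ω) (volume.restrict (Ioc 0 t)) :=
    hψ.integrable_mul hm
  simp only [hdv]
  refine ⟨(intervalIntegrable_iff_integrableOn_Ioc_of_le ht.1.le).2 i1,
    (intervalIntegrable_iff_integrableOn_Ioc_of_le ht.1.le).2 i2, ?_⟩
  have e2 : ∫ s in 0..t, inner ℝ (v s - M s ω • g) (θ s)
      = (∫ s in 0..t, inner ℝ (v s) (θ s)) - ∫ s in 0..t, inner ℝ (θ s) g * M s ω := by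
    rw [← intervalIntegral.integral_sub
      ((intervalIntegrable_iff_integrableOn_Ioc_of_le ht.1.le).2 i2)
      ((intervalIntegrable_iff_integrableOn_Ioc_of_le ht.1.le).2 i3)]
    exact intervalIntegral.integral_congr fun s _ => inner_sub_smul_left (v s) g (θ s) (M s ω)
  -- The noise contributes `M(t) ψ(t)` from `u(t)` and `-∫ ψ' M` from the product rule, which
  -- together are the chosen `I`.
  rw [h1, inner_add_left, e1, e2, hψe t ⟨ht.1, le_rfl⟩ hct, real_inner_smul_left]
  ring

end Heat

/-! ### Paths of the wave equation -/

section WavePath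

variable {V H : Type*} [NormedAddCommGroup V] [InnerProductSpace ℝ V] [CompleteSpace V]
  [NormedAddCommGroup H] [InnerProductSpace ℝ H] [CompleteSpace H]

/-- The duality formula along a path of the wave equation without its noise. -/
lemma inner_wave_path (J : V →L[ℝ] H) {t : ℝ} (ht : 0 ≤ t) {q u ζ θ : ℝ → V} {h dζ : ℝ → H}
    {m : ℝ → ℝ} {b c₁ : H} {c₂ : V} (hq : IntegrableOn q (Ioc 0 t)) (hh : IntegrableOn h (Ioc 0 t))
    (hm : MemLp m 2 (volume.restrict (Ioc 0 t))) (hdζ : MemLp dζ 2 (volume.restrict (Ioc 0 t)))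
    (hθ : MemLp θ 2 (volume.restrict (Ioc 0 t)))
    (hqh : ∀ᵐ s ∂(volume.restrict (Ioc 0 t)), J (q s) = (∫ r in 0..s, h r) + m s • b)
    (huq : ∀ᵐ s ∂(volume.restrict (Ioc 0 t)), u s = ∫ r in 0..s, q r)
    (hζ : ∀ᵐ s ∂(volume.restrict (Ioc 0 t)), J (ζ s) = c₁ + ∫ r in 0..s, dζ r)
    (hζt : J (ζ t) = c₁ + ∫ r in 0..t, dζ r)
    (hdζθ : ∀ᵐ s ∂(volume.restrict (Ioc 0 t)), adjoint J (dζ s) = c₂ + ∫ r in 0..s, θ r)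
    (hdζθt : adjoint J (dζ t) = c₂ + ∫ r in 0..t, θ r) :
    IntegrableOn (fun s => inner ℝ (h s) (J (ζ s))) (Ioc 0 t) ∧
    IntegrableOn (fun s => inner ℝ (θ s) (u s)) (Ioc 0 t) ∧
    inner ℝ (∫ s in 0..t, h s) (J (ζ t)) - inner ℝ (J (∫ s in 0..t, q s)) (dζ t)
      = (∫ s in 0..t, inner ℝ (h s) (J (ζ s))) - (∫ s in 0..t, inner ℝ (θ s) (u s))
        - ∫ s in 0..t, inner ℝ b (dζ s) * m s := by
  have hdζi : IntegrableOn dζ (Ioc 0 t) := hdζ.integrable (by norm_num)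
  have hθi : IntegrableOn θ (Ioc 0 t) := hθ.integrable (by norm_num)
  have i1 : IntegrableOn (fun s => inner ℝ (h s) (J (ζ s))) (Ioc 0 t) := by
    refine (integrableOn_bilin_primitive (innerBilin H) hh hdζi c₁).congr ?_
    filter_upwards [hζ] with s hs
    rw [hs, innerBilin_apply]
  have i2 : IntegrableOn (fun s => inner ℝ (θ s) (u s)) (Ioc 0 t) := by
    refine (integrableOn_bilin_primitive (innerBilin V) hθi hq 0).congr ?_
    filter_upwards [huq] with s hs
    rw [hs, zero_add, innerBilin_apply]
  have i3 : IntegrableOn (fun s => inner ℝ (∫ r in 0..s, h r) (dζ s)) (Ioc 0 t) := by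
    refine (integrableOn_bilin_primitive (innerBilin H) hdζi hh 0).congr
      (Eventually.of_forall fun s => ?_)
    simp only [zero_add, innerBilin_apply]
    rw [real_inner_comm]
  have i4 : IntegrableOn (fun s => inner ℝ b (dζ s) * m s) (Ioc 0 t) :=
    ((innerBilin H b).comp_memLp' hdζ).integrable_mul hm
  have e1 := bilin_primitive (innerBilin H) ht hh hdζi c₁
  have e2 := bilin_primitive (innerBilin V) ht hq hθi c₂
  simp only [innerBilin_apply] at e1 e2
  rw [intervalIntegral.integral_of_le ht (f := fun s => inner ℝ (h s) (c₁ + ∫ r in 0..s, dζ r)),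
    intervalIntegral.integral_of_le ht (f := fun s => inner ℝ (∫ r in 0..s, h r) (dζ s))] at e1
  rw [intervalIntegral.integral_of_le ht (f := fun s => inner ℝ (q s) (c₂ + ∫ r in 0..s, θ r)),
    intervalIntegral.integral_of_le ht (f := fun s => inner ℝ (∫ r in 0..s, q r) (θ s))] at e2
  have e3 : ∫ s in Ioc 0 t, inner ℝ (h s) (c₁ + ∫ r in 0..s, dζ r)
      = ∫ s in Ioc 0 t, inner ℝ (h s) (J (ζ s)) := by
    refine integral_congr_ae ?_
    filter_upwards [hζ] with s hs
    rw [hs]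
  have e4 : ∫ s in Ioc 0 t, inner ℝ (∫ r in 0..s, q r) (θ s)
      = ∫ s in Ioc 0 t, inner ℝ (θ s) (u s) := by
    refine integral_congr_ae ?_
    filter_upwards [huq] with s hs
    rw [hs, real_inner_comm]
  -- The velocity equation `J q = ∫ h + m b`, paired with `dζ`: the first term cancels the cross
  -- term of `e1`, the second is the noise correction.
  have e5 : ∫ s in Ioc 0 t, inner ℝ (q s) (c₂ + ∫ r in 0..s, θ r)
      = (∫ s in Ioc 0 t, inner ℝ (∫ r in 0..s, h r) (dζ s))
        + ∫ s in Ioc 0 t, inner ℝ b (dζ s) * m s := by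
    rw [← integral_add i3 i4]
    refine integral_congr_ae ?_
    filter_upwards [hqh, hdζθ] with s hs hs'
    rw [← hs', adjoint_inner_right, hs, inner_add_left, real_inner_smul_left, mul_comm (m s)]
  refine ⟨i1, i2, ?_⟩
  rw [← adjoint_inner_right, hζt, hdζθt, e1, e2, e3, e4, e5, intervalIntegral.integral_of_le ht,
    intervalIntegral.integral_of_le ht, intervalIntegral.integral_of_le ht]
  ring

lemma intervalIntegral_fst {a : ℝ → WithLp 2 (V × H)} {t : ℝ} (ht : 0 ≤ t)
    (ha : IntegrableOn a (Ioc 0 t)) : (∫ s in 0..t, a s).fst = ∫ s in 0..t, (a s).fst := by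
  rw [intervalIntegral.integral_of_le ht, intervalIntegral.integral_of_le ht]
  exact ((WithLp.fstL 2 ℝ V H).integral_comp_comm ha).symm

lemma intervalIntegral_snd {a : ℝ → WithLp 2 (V × H)} {t : ℝ} (ht : 0 ≤ t)
    (ha : IntegrableOn a (Ioc 0 t)) : (∫ s in 0..t, a s).snd = ∫ s in 0..t, (a s).snd := by
  rw [intervalIntegral.integral_of_le ht, intervalIntegral.integral_of_le ht]
  exact ((WithLp.sndL 2 ℝ V H).integral_comp_comm ha).symm

/-- The two components of a path of a first order system with noise in the second component. -/
lemma components_of_eq {a : ℝ → WithLp 2 (V × H)} {t : ℝ} (ht : 0 ≤ t)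
    (ha : IntegrableOn a (Ioc 0 t)) {x : V} {y b : H} {m : ℝ}
    (h : WithLp.toLp 2 (x, y) = -(∫ s in 0..t, a s) + m • WithLp.toLp 2 ((0 : V), b)) :
    x = (∫ s in 0..t, -(a s).fst) ∧ y = (∫ s in 0..t, -(a s).snd) + m • b := by
  constructor
  · have := congrArg (fun z : WithLp 2 (V × H) => z.fst) h
    simp only [WithLp.add_fst, WithLp.neg_fst, WithLp.smul_fst] at this
    change x = _ + m • (0 : V) at this
    rw [smul_zero, add_zero] at this
    rw [intervalIntegral.integral_neg, ← intervalIntegral_fst ht ha, ← this]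
  · have := congrArg (fun z : WithLp 2 (V × H) => z.snd) h
    simp only [WithLp.add_snd, WithLp.neg_snd, WithLp.smul_snd] at this
    rw [intervalIntegral.integral_neg, ← intervalIntegral_snd ht ha]
    exact this

lemma smul_toLp_zero (r : ℝ) (b : H) :
    (WithLp.toLp 2 ((0 : V), r • b) : WithLp 2 (V × H)) = r • WithLp.toLp 2 ((0 : V), b) := by
  rw [← WithLp.toLp_smul, Prod.smul_mk, smul_zero]

lemma eq_of_smul_toLp_zero {r r' : ℝ} {b : H}
    (h : r • (WithLp.toLp 2 ((0 : V), b) : WithLp 2 (V × H)) = r' • WithLp.toLp 2 ((0 : V), b)) :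
    r • b = r' • b := congrArg (fun z : WithLp 2 (V × H) => z.snd) h

end WavePath

/-! ### The wave equation -/

section Wave

variable {d : ℕ} {D : Opens (Euc d)}

lemma applyOrZero_waveOperator {u : H10 D} {p : L2 D}
    (hx : (WithLp.toLp 2 (u, p) : WaveSpace D) ∈ (waveOperator D).domain) :
    toL2 D (applyOrZero (waveOperator D) (WithLp.toLp 2 (u, p))).fst = - p ∧
      applyOrZero (dirichletLaplacian D) (toL2 D u)
        = -(applyOrZero (waveOperator D) (WithLp.toLp 2 (u, p))).snd := by
  have hm : ((WithLp.toLp 2 (u, p) : WaveSpace D), waveOperator D ⟨_, hx⟩) ∈ waveGraph D := by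
    rw [← waveOperator_graph]
    exact (waveOperator D).mem_graph ⟨_, hx⟩
  rw [applyOrZero, dif_pos hx]
  obtain ⟨h1, h2⟩ := hm
  refine ⟨h1, ?_⟩
  rw [← dirichletLaplacian_graph, LinearPMap.mem_graph_iff] at h2
  obtain ⟨y, hy1, hy2⟩ := h2
  have hy1' : (y : L2 D) = toL2 D u := hy1
  have hy : toL2 D u ∈ (dirichletLaplacian D).domain := hy1' ▸ y.2
  rw [applyOrZero, dif_pos hy, show (⟨toL2 D u, hy⟩ : (dirichletLaplacian D).domain) = y from
    Subtype.ext hy1'.symm]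
  exact hy2

end Wave

section Wave

variable {d : ℕ} {D : Opens (Euc d)} {T : ℝ} {Ω : Type*} [MeasurableSpace Ω] {P : Measure Ω}
  [IsProbabilityMeasure P] {W : ℝ≥0 → Ω → ℝ} {f : ℝ → ℝ} {g : L2 D}

/-- Strong solutions of the stochastic wave equation in terms of a process `M` of real Wiener
integrals. -/
lemma IsStrongSolutionWave.exists_wiener (hW : IsPreBrownianReal W P) (hT : 0 ≤ T)
    (hf : MemLp f 2 (volume.restrict (Icc 0 T))) {u : ℝ → Ω → H10 D} {u' : ℝ → Ω → L2 D}
    (hu : IsStrongSolutionWave D P W T f g u u') :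
    ∃ (F : ℝ → ℝ) (M : ℝ → Ω → ℝ), (∀ s, F s • g = f s • g) ∧
      MemLp F 2 (volume.restrict (Icc 0 T)) ∧
      AEStronglyMeasurable (fun z : ℝ × Ω => M z.1 z.2) ((volume.restrict (Icc 0 T)).prod P) ∧
      (∀ t ∈ Icc 0 T, IsWienerIntegral P W t F (M t)) ∧
      ∃ (q : ℝ → Ω → H10 D) (h : ℝ → Ω → L2 D),
        (∀ᵐ ω ∂P, IntegrableOn (fun s => q s ω) (Icc 0 T)) ∧
        (∀ᵐ ω ∂P, IntegrableOn (fun s => h s ω) (Icc 0 T)) ∧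
        (∀ᵐ ω ∂P, ∀ᵐ s ∂(volume.restrict (Icc 0 T)), toL2 D (q s ω) = u' s ω ∧
          applyOrZero (dirichletLaplacian D) (toL2 D (u s ω)) = h s ω) ∧
        (∀ t ∈ Icc 0 T, ∀ᵐ ω ∂P, u t ω = (∫ s in 0..t, q s ω) ∧
          u' t ω = (∫ s in 0..t, h s ω) + M t ω • g) ∧
        ∀ᵐ ω ∂P, ∀ᵐ t ∂(volume.restrict (Icc 0 T)), u t ω = (∫ s in 0..t, q s ω) ∧
          u' t ω = (∫ s in 0..t, h s ω) + M t ω • g := by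
  have hu1 : IsStrongSolution P W T (waveOperator D)
      (fun s => f s • (WithLp.toLp 2 ((0 : H10 D), g) : WaveSpace D))
      (fun t ω => (WithLp.toLp 2 (u t ω, u' t ω) : WaveSpace D)) := by
    have := hu
    unfold IsStrongSolutionWave at this
    simp_rw [smul_toLp_zero] at this
    exact this
  obtain ⟨F, M, hFb, hF, hMj, hMW, hMt, hMae⟩ := hu1.exists_wiener hW hT hf
  set a : ℝ → Ω → WaveSpace D := fun s ω =>
    applyOrZero (waveOperator D) (WithLp.toLp 2 (u s ω, u' s ω)) with ha
  have hai : ∀ᵐ ω ∂P, IntegrableOn (fun s => a s ω) (Icc 0 T) := hu1.integrable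
  have hsub : ∀ {ω t}, t ∈ Icc 0 T → IntegrableOn (fun s => a s ω) (Icc 0 T) →
      IntegrableOn (fun s => a s ω) (Ioc 0 t) := fun ht h =>
    h.mono_set (Ioc_subset_Icc_self.trans (Icc_subset_Icc_right ht.2))
  refine ⟨F, M, fun s => eq_of_smul_toLp_zero (hFb s), hF, hMj, hMW,
    -- With `A(u, p) = (-p, -Δu)`, these are the velocity as an element of `H¹₀` and `Δu`.
    fun s ω => -(a s ω).fst, fun s ω => -(a s ω).snd, ?_, ?_, ?_, ?_, ?_⟩
  · filter_upwards [hai] with ω h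
    exact ((WithLp.fstL 2 ℝ (H10 D) (L2 D)).integrable_comp h).neg
  · filter_upwards [hai] with ω h
    exact ((WithLp.sndL 2 ℝ (H10 D) (L2 D)).integrable_comp h).neg
  · filter_upwards [hu1.mem_domain] with ω h
    filter_upwards [h] with s hs
    obtain ⟨h1, h2⟩ := applyOrZero_waveOperator hs
    exact ⟨by rw [map_neg, h1, neg_neg], h2⟩
  · intro t ht
    filter_upwards [hMt t ht, hai] with ω h1 h2
    exact components_of_eq ht.1 (hsub ht h2) h1
  · filter_upwards [hMae, hai] with ω h1 h2
    filter_upwards [h1, ae_restrict_mem measurableSet_Icc] with t h1 ht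
    exact components_of_eq ht.1 (hsub ht h2) h1

set_option maxHeartbeats 1000000 in
/-- The duality formula for strong solutions of the stochastic wave equation. -/
theorem IsStrongSolutionWave.duality (hW : IsPreBrownianReal W P) (hT : 0 < T)
    (hf : MemLp f 2 (volume.restrict (Icc 0 T))) {u : ℝ → Ω → H10 D} {u' : ℝ → Ω → L2 D}
    (hu : IsStrongSolutionWave D P W T f g u u')
    {ζ : ℝ → H10 D} {dζ : ℝ → L2 D} {ddζ : ℝ → HNeg1 D}
    (hζ : MemLp ζ 2 (volume.restrict (Icc 0 T)))
    (hdζ : MemLp dζ 2 (volume.restrict (Icc 0 T)))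
    (hddζ : MemLp ddζ 2 (volume.restrict (Icc 0 T)))
    (hw : HasWeakTimeDeriv T (fun s => toL2 D (ζ s)) dζ)
    (hw' : HasWeakTimeDeriv T (fun s => toHNeg1 D (dζ s)) ddζ) :
    ∀ᵐ t ∂(volume.restrict (Icc 0 T)), ∃ I : Ω → ℝ,
      IsWienerIntegral P W t (fun s => f s * inner ℝ g (toL2 D (ζ s))) I ∧
      ∀ᵐ ω ∂P,
        IntervalIntegrable (fun s =>
          inner ℝ (applyOrZero (dirichletLaplacian D) (toL2 D (u s ω))) (toL2 D (ζ s)))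
          volume 0 t ∧
        IntervalIntegrable (fun s => ddζ s (u s ω)) volume 0 t ∧
        inner ℝ (u' t ω) (toL2 D (ζ t)) - inner ℝ (toL2 D (u t ω)) (dζ t)
          = (∫ s in 0..t,
              inner ℝ (applyOrZero (dirichletLaplacian D) (toL2 D (u s ω))) (toL2 D (ζ s)))
            - (∫ s in 0..t, ddζ s (u s ω))
            + I ω := by
  obtain ⟨F, M, hFb, hF, hMj, hMW, q, h, hqi, hhi, hqh, hMt, hMae⟩ :=
    hu.exists_wiener hW hT.le hf
  obtain ⟨c₂, θ, hθ, hdθ, hc₂⟩ := exists_riesz_primitive_of_embedding (V := H10 D) (H := L2 D)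
    (toL2 D) hT hdζ hddζ hw'
  obtain ⟨c₁, hc₁⟩ := hw.exists_eq_primitive hT
    (((toL2 D).comp_memLp' hζ).integrable (by norm_num)) (hdζ.integrable (by norm_num))
  have hpos : ∀ᵐ t ∂(volume.restrict (Icc 0 T)), t ∈ Ioc 0 T := by
    rw [← Measure.restrict_congr_set Ioc_ae_eq_Icc]
    exact ae_restrict_mem measurableSet_Ioc
  -- Both `ζ` and `∂ₜζ` must agree with their continuous representatives at `t`.
  filter_upwards [hc₁, hc₂, hpos] with t hct₁ hct₂ ht
  have hle := restrict_Ioc_le ht.2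
  have htI : t ∈ Icc 0 T := Ioc_subset_Icc_self ht
  have hdζt := hdζ.mono_measure hle
  have hdζi : IntegrableOn dζ (Ioc 0 t) := hdζt.integrable (by norm_num)
  have hψ : MemLp (fun s => inner ℝ g (dζ s)) 2 (volume.restrict (Ioc 0 t)) :=
    (innerBilin (L2 D) g).comp_memLp' hdζt
  have hMjt : AEStronglyMeasurable (fun z : ℝ × Ω => M z.1 z.2)
      ((volume.restrict (Ioc 0 t)).prod P) := hMj.mono_measure (Measure.prod_mono hle le_rfl)
  have hMWt : ∀ s ∈ Ioc 0 t, IsWienerIntegral P W s F (M s) := fun s hs =>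
    hMW s ⟨hs.1.le, hs.2.trans ht.2⟩
  have hFt := hF.mono_measure hle
  -- Here `ζ` is already a primitive in `L²(D)`, so `⟨g, ζ⟩` has derivative `⟨g, dζ⟩`.
  have hI := isWienerIntegral_mul_primitive hW ht.1 hFt hMjt hMWt hψ (inner ℝ g c₁)
  have hψe : ∀ s ∈ Ioc 0 t, toL2 D (ζ s) = c₁ + ∫ r in 0..s, dζ r →
      inner ℝ g c₁ + ∫ r in 0..s, inner ℝ g (dζ r) = inner ℝ g (toL2 D (ζ s)) := by
    intro s hs hcs
    rw [hcs]
    exact (inner_add_primitive_right g c₁ hs.1.le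
      (hdζi.mono_set (Ioc_subset_Ioc_right hs.2))).symm
  refine ⟨_, hI.congr ?_ Filter.EventuallyEq.rfl, ?_⟩
  · filter_upwards [ae_mono hle hc₁, ae_restrict_mem measurableSet_Ioc] with s hs hsm
    rw [hψe s hsm hs, ← real_inner_smul_left, ← real_inner_smul_left, hFb]
  filter_upwards [hMt t htI, hMae, hqi, hhi, hqh, ae_memLp_wiener hW hFt hMjt hMWt]
    with ω h1 h2 h3 h4 h5 hm
  have hqt : IntegrableOn (fun s => q s ω) (Ioc 0 t) := Integrable.mono_measure h3 hle
  have hht : IntegrableOn (fun s => h s ω) (Ioc 0 t) := Integrable.mono_measure h4 hle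
  obtain ⟨i1, i2, e⟩ := inner_wave_path (toL2 D) ht.1.le (u := fun s => u s ω) hqt hht hm hdζt
    (hθ.mono_measure hle)
    (by
      filter_upwards [ae_mono hle h2, ae_mono hle h5] with s hs hs'
      rw [hs'.1, hs.2])
    (ae_mono hle (h2.mono fun s hs => hs.1)) (ae_mono hle hc₁) hct₁ (ae_mono hle hc₂) hct₂
  have hΔ : (fun s => inner ℝ (applyOrZero (dirichletLaplacian D) (toL2 D (u s ω)))
      (toL2 D (ζ s))) =ᵐ[volume.restrict (Ioc 0 t)] fun s => inner ℝ (h s ω) (toL2 D (ζ s)) := by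
    filter_upwards [ae_mono hle h5] with s hs
    rw [hs.2]
  have hΔi : ∫ s in 0..t, inner ℝ (applyOrZero (dirichletLaplacian D) (toL2 D (u s ω)))
      (toL2 D (ζ s)) = ∫ s in 0..t, inner ℝ (h s ω) (toL2 D (ζ s)) := by
    rw [intervalIntegral.integral_of_le ht.1.le, intervalIntegral.integral_of_le ht.1.le]
    exact integral_congr_ae hΔ
  refine ⟨(intervalIntegrable_iff_integrableOn_Ioc_of_le ht.1.le).2 (Integrable.congr i1 hΔ.symm),
    ?_, ?_⟩
  · simp only [hdθ]
    exact (intervalIntegrable_iff_integrableOn_Ioc_of_le ht.1.le).2 i2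
  · simp only [hdθ]
    rw [hΔi, h1.2, h1.1, inner_add_left, real_inner_smul_left, hψe t ⟨ht.1, le_rfl⟩ hct₁]
    linarith

end Wave

end StochEvol

end

/-! ### The theorem -/

open StochEvol MeasureTheory ProbabilityTheory Set TopologicalSpace
open scoped NNReal ENNReal

theorem theorem3p1 {d : ℕ} (hd : 0 < d)
    (D : Opens (Euc d)) (hD : Bornology.IsBounded (D : Set (Euc d)))
    {T : ℝ} (hT : 0 < T)
    {Ω : Type*} [MeasurableSpace Ω] (P : Measure Ω) [IsProbabilityMeasure P]
    (W : ℝ≥0 → Ω → ℝ) (hW : IsBrownianReal W P)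
    (f : ℝ → ℝ) (hf : MemLp f 2 (volume.restrict (Icc 0 T)))
    (g : H10 D) :
    -- the stochastic heat equation
    (∀ u : ℝ → Ω → L2 D, IsStrongSolutionHeat D P W T f (toL2 D g) u →
      ∀ (ζ : ℝ → H10 D) (dζ : ℝ → HNeg1 D),
        MemLp ζ 2 (volume.restrict (Icc 0 T)) →
        MemLp dζ 2 (volume.restrict (Icc 0 T)) →
        HasWeakTimeDeriv T (fun s => toHNeg1 D (toL2 D (ζ s))) dζ →
        ∀ᵐ t ∂(volume.restrict (Icc 0 T)), ∃ I : Ω → ℝ,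
          IsWienerIntegral P W t (fun s => f s * inner ℝ (toL2 D g) (toL2 D (ζ s))) I ∧
          ∀ᵐ ω ∂P,
            IntervalIntegrable (fun s =>
              inner ℝ (applyOrZero (dirichletLaplacian D) (u s ω)) (toL2 D (ζ s))) volume 0 t ∧
            IntervalIntegrable (fun s => dζ s (liftH10 D (u s ω))) volume 0 t ∧
            inner ℝ (u t ω) (toL2 D (ζ t))
              = (∫ s in 0..t,
                  inner ℝ (applyOrZero (dirichletLaplacian D) (u s ω)) (toL2 D (ζ s)))
                + (∫ s in 0..t, dζ s (liftH10 D (u s ω)))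
                + I ω) ∧
    -- the stochastic wave equation
    (∀ (u : ℝ → Ω → H10 D) (u' : ℝ → Ω → L2 D),
      IsStrongSolutionWave D P W T f (toL2 D g) u u' →
      ∀ (ζ : ℝ → H10 D) (dζ : ℝ → L2 D) (ddζ : ℝ → HNeg1 D),
        MemLp ζ 2 (volume.restrict (Icc 0 T)) →
        MemLp dζ 2 (volume.restrict (Icc 0 T)) →
        MemLp ddζ 2 (volume.restrict (Icc 0 T)) →
        HasWeakTimeDeriv T (fun s => toL2 D (ζ s)) dζ →
        HasWeakTimeDeriv T (fun s => toHNeg1 D (dζ s)) ddζ →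
        ∀ᵐ t ∂(volume.restrict (Icc 0 T)), ∃ I : Ω → ℝ,
          IsWienerIntegral P W t (fun s => f s * inner ℝ (toL2 D g) (toL2 D (ζ s))) I ∧
          ∀ᵐ ω ∂P,
            IntervalIntegrable (fun s =>
              inner ℝ (applyOrZero (dirichletLaplacian D) (toL2 D (u s ω))) (toL2 D (ζ s)))
              volume 0 t ∧
            IntervalIntegrable (fun s => ddζ s (u s ω)) volume 0 t ∧
            inner ℝ (u' t ω) (toL2 D (ζ t)) - inner ℝ (toL2 D (u t ω)) (dζ t)
              = (∫ s in 0..t,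
                  inner ℝ (applyOrZero (dirichletLaplacian D) (toL2 D (u s ω))) (toL2 D (ζ s)))
                - (∫ s in 0..t, ddζ s (u s ω))
                + I ω) := by
  exact ⟨fun u hu ζ dζ hζ hdζ hw => hu.duality hW.toIsPreBrownianReal hT hf hζ hdζ hw,
    fun u u' hu ζ dζ ddζ hζ hdζ hddζ hw hw' =>
      hu.duality hW.toIsPreBrownianReal hT hf hζ hdζ hddζ hw hw'⟩
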